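/- All manifolds are smooth, finite-dimensional, Hausdorff and second countable. Let $G$ be a Lie group, $H\subset G$ a closed subgroup (with its structure of embedded Lie subgroup), $\pi:P\to X$ a smooth principal bundle with structure group $G$ (acting on the right), and $V$ a manifold with a smooth left action of $H$ (for instance a vector space carrying a linear representation of $H$). For a right $H$-manifold $Q$ let $(Q\times V)/H$ denote the quotient of $Q\times V$ by the identification $(qh,v)\sim(q,hv)$, $h\in H$. Put $$W=(G\times V)/H,\qquad \Sigma=P/H,\qquad Y=(P\times V)/H .$$ Then $G/H$, $W$, $\Sigma$ and $Y$, with their quotient topologies, carry smooth manifold structures for which the following holds. (i) $G\to G/H$ is a principal $H$-bundle and $W\to G/H$, $[g,v]\mapsto gH$, is the bundle with typical fibre $V$ associated with it. Likewise $P\to\Sigma$ is a principal $H$-bundle and $Y\to\Sigma$, $[p,v]\mapsto pH$, is the bundle with typical fibre $V$ associated with it; and $\Sigma\to X$ is the bundle with typical fibre $G/H$ associated with $P\to X$, by way of $P\times G/H\to\Sigma$, $(p,gH)\mapsto pgH$. (ii) $G$ acts smoothly on $W$ by $g\cdot[g',v]=[gg',v]$ (the induced representation), and this action covers the action of $G$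 on $G/H$ by left translations. (iii) The composite bundle $Y\to\Sigma\to X$ is the fibre bundle with structure group $G$ and typical fibre $W$ associated with the principal bundle $P\to X$: the map $P\times W\to Y$, $(p,[g,v])\mapsto[pg,v]$, is smooth and induces a bijection $(P\times W)/G\to Y$ over $X$, where $(pg,w)\sim(p,g\cdot w)$, and every bundle chart $\pi^{-1}(U)\cong U\times G$, $p\mapsto(\pi(p),\gamma(p))$, of $P$ induces a bundle chart of $Y\to X$ over $U$, that is, a diffeomorphism from the part of $Y$ over $U$ onto $U\times W$, with $[pg,v]\mapsto(\pi(p),\gamma(p)\cdot[g,v])$. (iv) The typical fibre of this composite bundle is the bundle $W\to G/H$: the map $P\times W\to Y$ covers the map $P\times G/H\to\Sigma$ of (i). -/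

import Mathlib

open scoped Manifold ContDiff
open MulOpposite (op)

section Quotients

/-- A subgroup `H` of `G` acts on the right wherever `G` does: `p · h = p · (h : G)`.
As everywhere below, a right action is an action of the opposite group,
`p · g` being written `op g • p`. -/
instance subgroupRightAction {G P : Type*} [Group G] [MulAction Gᵐᵒᵖ P] (H : Subgroup G) :
    MulAction (↥H)ᵐᵒᵖ P :=
  MulAction.compHom P (MonoidHom.op H.subtype)

/-- The identification `(q · k, f) ~ (q, k · f)` on `Q × F`, for a group `K` acting on `Q` on the
right and on `F` on the left. -/
def assocSetoid (K Q F : Type*) [Group K] [MulAction Kᵐᵒᵖ Q] [MulAction K F] :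
    Setoid (Q × F) where
  r a b := ∃ k : K, a.1 = op k • b.1 ∧ b.2 = k • a.2
  iseqv :=
    { refl := fun a => ⟨1, by simp, by simp⟩
      symm := by
        rintro a b ⟨k, h1, h2⟩
        exact ⟨k⁻¹, by rw [h1, smul_smul, ← MulOpposite.op_mul]; simp, by rw [h2]; simp⟩
      trans := by
        rintro a b c ⟨k, h1, h2⟩ ⟨l, h3, h4⟩
        exact ⟨l * k, by rw [h1, h3, smul_smul, ← MulOpposite.op_mul],
          by rw [h4, h2, smul_smul]⟩ }

/-- The space `(Q × F) / K`, with the quotient topology. -/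
abbrev AssocSpace (K Q F : Type*) [Group K] [MulAction Kᵐᵒᵖ Q] [MulAction K F] : Type _ :=
  Quotient (assocSetoid K Q F)

/-- The quotient map `Q × F → (Q × F) / K`. -/
def AssocSpace.mk (K : Type*) {Q F : Type*} [Group K] [MulAction Kᵐᵒᵖ Q] [MulAction K F] :
    Q × F → AssocSpace K Q F :=
  Quotient.mk (assocSetoid K Q F)

/-- The projection `(Q × F) / K → B`, `[q, f] ↦ π q`, for a `K`-invariant map `π : Q → B`. -/
def AssocSpace.proj {K Q F B : Type*} [Group K] [MulAction Kᵐᵒᵖ Q] [MulAction K F] (π : Q → B)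
    (hπ : ∀ (q : Q) (k : K), π (op k • q) = π q) : AssocSpace K Q F → B :=
  Quotient.lift (fun a => π a.1) (by
    rintro a b ⟨k, h1, -⟩
    rw [h1, hπ])

/-- The quotient `P / K` of `P` by a right action of `K`, with the quotient topology. -/
abbrev RightQuotient (K P : Type*) [Group K] [MulAction Kᵐᵒᵖ P] : Type _ :=
  MulAction.orbitRel.Quotient Kᵐᵒᵖ P

/-- The quotient map `P → P / K`. -/
def RightQuotient.mk (K : Type*) {P : Type*} [Group K] [MulAction Kᵐᵒᵖ P] :
    P → RightQuotient K P :=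
  Quotient.mk (MulAction.orbitRel Kᵐᵒᵖ P)

theorem RightQuotient.mk_smul {K P : Type*} [Group K] [MulAction Kᵐᵒᵖ P] (p : P) (k : K) :
    RightQuotient.mk K (op k • p) = RightQuotient.mk K p :=
  Quotient.sound ⟨op k, rfl⟩

/-- The projection `P / H → X` induced by a `G`-invariant map `π : P → X`. -/
def RightQuotient.proj {G P X : Type*} [Group G] [MulAction Gᵐᵒᵖ P] (H : Subgroup G) (π : P → X)
    (hπ : ∀ (p : P) (g : G), π (op g • p) = π p) : RightQuotient ↥H P → X :=
  Quotient.lift π (by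
    rintro _ b ⟨h, rfl⟩
    exact hπ b (h.unop : G))

/-- The projection `π_YΣ : Y = (P × V) / H → P / H`, `[p, v] ↦ p H`. -/
def compositeProj {G P : Type*} [Group G] [MulAction Gᵐᵒᵖ P] (H : Subgroup G) (V : Type*)
    [MulAction ↥H V] : AssocSpace ↥H P V → RightQuotient ↥H P :=
  AssocSpace.proj (RightQuotient.mk ↥H) RightQuotient.mk_smul

theorem quotientGroup_mk_smul {G : Type*} [Group G] (H : Subgroup G) (g : G) (h : ↥H) :
    (QuotientGroup.mk (op h • g) : G ⧸ H) = QuotientGroup.mk g :=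
  QuotientGroup.mk_mul_of_mem g h.2

/-- The projection `π_WH : W = (G × V) / H → G / H`, `[g, v] ↦ g H`. -/
def inducedProj {G : Type*} [Group G] (H : Subgroup G) (V : Type*) [MulAction ↥H V] :
    AssocSpace ↥H G V → G ⧸ H :=
  AssocSpace.proj (QuotientGroup.mk : G → G ⧸ H) (quotientGroup_mk_smul H)

/-- The action of `G` on `W = (G × V) / H` (the induced representation): `g · [g', v] = [g g', v]`. -/
instance inducedAction {G : Type*} [Group G] (H : Subgroup G) (V : Type*) [MulAction ↥H V] :
    MulAction G (AssocSpace ↥H G V) where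
  smul g := Quotient.map (fun a => (g * a.1, a.2)) (by
    rintro a b ⟨h, h1, h2⟩
    refine ⟨h, ?_, h2⟩
    change g * a.1 = g * b.1 * (h : G)
    rw [h1, mul_assoc]
    rfl)
  one_smul := by
    rintro ⟨a⟩
    exact congrArg (AssocSpace.mk ↥H) (Prod.ext (one_mul a.1) rfl)
  mul_smul := by
    rintro g g' ⟨a⟩
    exact congrArg (AssocSpace.mk ↥H) (Prod.ext (mul_assoc g g' a.1) rfl)

/-- The map `P × G / H → P / H`, `(p, g H) ↦ (p · g) H`. -/
def homogeneousMap {G P : Type*} [Group G] [MulAction Gᵐᵒᵖ P] (H : Subgroup G) :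
    P × (G ⧸ H) → RightQuotient ↥H P := fun a =>
  Quotient.lift (s := QuotientGroup.leftRel H) (fun g : G => RightQuotient.mk ↥H (op g • a.1)) (by
    rintro _ g ⟨⟨h, hh⟩, rfl⟩
    change RightQuotient.mk ↥H (op (g * h.unop) • a.1) = _
    rw [MulOpposite.op_mul, mul_smul]
    exact RightQuotient.mk_smul (op g • a.1) (⟨h.unop, hh⟩ : ↥H)) a.2

/-- The map `P × W → Y`, `(p, [g, v]) ↦ [p · g, v]`, with `W = (G × V) / H` and
`Y = (P × V) / H`. -/
def compositeMap {G P : Type*} [Group G] [MulAction Gᵐᵒᵖ P] (H : Subgroup G) (V : Type*)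
    [MulAction ↥H V] : P × AssocSpace ↥H G V → AssocSpace ↥H P V := fun a =>
  Quotient.map (fun b : G × V => (op b.1 • a.1, b.2)) (by
    rintro b c ⟨h, h1, h2⟩
    refine ⟨h, ?_, h2⟩
    change op b.1 • a.1 = op (h : G) • op c.1 • a.1
    rw [h1, smul_smul]
    rfl) a.2

end Quotients

section Bundles

variable {EK HK EQ HQ EB HB EF HF EY HY : Type*}
  [NormedAddCommGroup EK] [NormedSpace ℝ EK] [TopologicalSpace HK]
  [NormedAddCommGroup EQ] [NormedSpace ℝ EQ] [TopologicalSpace HQ]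
  [NormedAddCommGroup EB] [NormedSpace ℝ EB] [TopologicalSpace HB]
  [NormedAddCommGroup EF] [NormedSpace ℝ EF] [TopologicalSpace HF]
  [NormedAddCommGroup EY] [NormedSpace ℝ EY] [TopologicalSpace HY]
  (IK : ModelWithCorners ℝ EK HK) (IQ : ModelWithCorners ℝ EQ HQ)
  (IB : ModelWithCorners ℝ EB HB) (IF : ModelWithCorners ℝ EF HF)
  (IY : ModelWithCorners ℝ EY HY)
  {K Q B F Y : Type*}
  [TopologicalSpace K] [ChartedSpace HK K] [Group K]
  [TopologicalSpace Q] [ChartedSpace HQ Q] [MulAction Kᵐᵒᵖ Q]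
  [TopologicalSpace B] [ChartedSpace HB B]
  [TopologicalSpace F] [ChartedSpace HF F] [MulAction K F]
  [TopologicalSpace Y] [ChartedSpace HY Y]

/-- A local trivialization `π⁻¹(U) ≃ U × F` is smooth if it is a diffeomorphism. -/
structure IsSmoothTrivialization {π : Y → B} (e : Bundle.Trivialization F π) : Prop where
  contMDiffOn : ContMDiffOn IY (IB.prod IF) ∞ e e.source
  contMDiffOn_symm : ContMDiffOn (IB.prod IF) IY ∞ e.toOpenPartialHomeomorph.symm e.target

/-- A bundle chart of a principal bundle: a smooth local trivialization `π⁻¹(U) ≃ U × K` which is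
equivariant under the right action of `K`. -/
structure IsPrincipalTrivialization {π : Q → B} (e : Bundle.Trivialization K π) : Prop where
  smooth : IsSmoothTrivialization IB IK IQ e
  map_smul : ∀ q ∈ e.source, ∀ k : K, (e (op k • q)).2 = (e q).2 * k

/-- `π : Q → B` is a smooth principal bundle with structure group `K` (acting on the right). -/
structure IsPrincipalBundle (K : Type*) [TopologicalSpace K] [ChartedSpace HK K] [Group K]
    [MulAction Kᵐᵒᵖ Q] (π : Q → B) : Prop where
  contMDiff_smul : ContMDiff (IQ.prod IK) IQ ∞ (fun a : Q × K => op a.2 • a.1)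
  contMDiff_proj : ContMDiff IQ IB ∞ π
  proj_smul : ∀ (q : Q) (k : K), π (op k • q) = π q
  exists_trivialization : ∀ b : B, ∃ e : Bundle.Trivialization K π,
    b ∈ e.baseSet ∧ IsPrincipalTrivialization IK IQ IB e

/-- `πY : Y → B` is the smooth fibre bundle with typical fibre `F` and structure group `K` that is
associated with the principal bundle `π : Q → B`, by way of the map `m : Q × F → Y`.
That is, `K` acts smoothly on `F` on the left; `m` is smooth and identifies `(Q × F) / K` with `Y`
over `B`; and each bundle chart of `Q` over an open set `U` induces a bundle chart
`πY⁻¹(U) ≃ U × F` (so that the transition functions of `Y` are those of `Q`, acting on `F`). -/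
structure IsAssociatedBundle (K : Type*) [TopologicalSpace K] [ChartedSpace HK K] [Group K]
    [MulAction Kᵐᵒᵖ Q] [MulAction K F] (π : Q → B) (πY : Y → B) (m : Q × F → Y) : Prop where
  isPrincipalBundle : IsPrincipalBundle IK IQ IB K π
  contMDiffSMul : ContMDiffSMul IK IF ∞ K F
  contMDiff_proj : ContMDiff IY IB ∞ πY
  contMDiff_map : ContMDiff (IQ.prod IF) IY ∞ m
  proj_map : ∀ a : Q × F, πY (m a) = π a.1
  map_surjective : Function.Surjective m
  map_eq_iff : ∀ a b : Q × F, m a = m b ↔ assocSetoid K Q F a b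
  induced_trivialization : ∀ e : Bundle.Trivialization K π, IsPrincipalTrivialization IK IQ IB e →
    ∃ e' : Bundle.Trivialization F πY, e'.baseSet = e.baseSet ∧
      IsSmoothTrivialization IB IF IY e' ∧
      ∀ q ∈ e.source, ∀ f : F, e' (m (q, f)) = (π q, (e q).2 • f)

end Bundles

/-- The standing requirements on a manifold modelled on `E`: smooth, Hausdorff and second
countable. -/
structure IsSmoothManifold (E : Type*) [NormedAddCommGroup E] [NormedSpace ℝ E] (M : Type*)
    [TopologicalSpace M] [ChartedSpace E M] : Prop where
  isManifold : IsManifold 𝓘(ℝ, E) ∞ M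
  t2Space : T2Space M
  secondCountableTopology : SecondCountableTopology M

section ManifoldConstruction

open Set

/-- A space which is covered by open partial homeomorphisms into a smooth manifold `M`, with smooth
changes of coordinates, is a smooth manifold for which these are local diffeomorphisms. -/
theorem exists_chartedSpace_of_openPartialHomeomorph {E H : Type*} [NormedAddCommGroup E]
    [NormedSpace ℝ E] [TopologicalSpace H] (I : ModelWithCorners ℝ E H) {M Y ι : Type*}
    [TopologicalSpace M] [ChartedSpace H M] [IsManifold I ∞ M] [TopologicalSpace Y]
    (e : ι → OpenPartialHomeomorph Y M) (cover : ∀ y, ∃ i, y ∈ (e i).source)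
    (compat : ∀ i j, ContMDiffOn I I ∞ (e j ∘ (e i).symm) ((e i).symm ≫ₕ e j).source) :
    ∃ _ : ChartedSpace H Y, IsManifold I ∞ Y ∧
      ∀ i, ContMDiffOn I I ∞ (e i) (e i).source ∧ ContMDiffOn I I ∞ (e i).symm (e i).target := by
  choose i hi using cover
  let cM : ChartedSpace M Y :=
    { atlas := range e
      chartAt := fun y => e (i y)
      mem_chart_source := hi
      chart_mem_atlas := fun y => mem_range_self _ }
  let cs : ChartedSpace H Y := ChartedSpace.comp H M Y
  have key : ∀ i j, ∀ c ∈ atlas H M, ContMDiffOn I 𝓘(ℝ, E) ∞ (I ∘ c ∘ e j ∘ (e i).symm)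
      ((e i).symm ≫ₕ e j ≫ₕ c).source := by
    intro i j c hc
    have h1 : ContMDiffOn I I ∞ c c.source :=
      contMDiffOn_of_mem_maximalAtlas (IsManifold.subset_maximalAtlas hc)
    have h2 : ContMDiff I 𝓘(ℝ, E) ∞ I := I.contMDiff
    refine h2.comp_contMDiffOn (h1.comp ((compat i j).mono ?_) ?_)
    · intro x hx
      simp only [mfld_simps] at hx ⊢
      tauto
    · intro x hx
      simp only [mfld_simps] at hx ⊢
      tauto
  have hman : IsManifold I ∞ Y := by
    refine isManifold_of_contDiffOn I ∞ Y ?_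
    rintro _ _ ⟨_, ⟨i, rfl⟩, c, hc, rfl⟩ ⟨_, ⟨j, rfl⟩, c', hc', rfl⟩
    rw [← contMDiffOn_iff_contDiffOn]
    have h1 : ContMDiffOn I I ∞ c.symm c.target :=
      contMDiffOn_symm_of_mem_maximalAtlas (IsManifold.subset_maximalAtlas hc)
    have h2 : ContMDiffOn 𝓘(ℝ, E) I ∞ I.symm (range I) := I.contMDiffOn_symm
    refine ((key i j c' hc').comp (h1.comp (h2.mono inter_subset_right) ?_) ?_).congr ?_
    · intro x hx
      simp only [mfld_simps] at hx ⊢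
      tauto
    · intro x hx
      simp only [mfld_simps] at hx ⊢
      tauto
    · intro x hx
      simp only [mfld_simps]
  have chart_eq : ∀ y, chartAt H y = e (i y) ≫ₕ chartAt H (e (i y) y) := fun _ => rfl
  refine ⟨cs, hman, fun j => ⟨?_, ?_⟩⟩
  · intro y hy
    set c := chartAt H (e (i y) y)
    have hc : c ∈ IsManifold.maximalAtlas I ∞ M :=
      IsManifold.subset_maximalAtlas (chart_mem_atlas H _)
    have h1 : ContMDiffOn I I ∞ (e (i y) ≫ₕ c) (e (i y) ≫ₕ c).source :=
      chart_eq y ▸ contMDiffOn_chart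
    have h2 : ContMDiffOn I I ∞ c.symm c.target := contMDiffOn_symm_of_mem_maximalAtlas hc
    have hy' : y ∈ (e (i y) ≫ₕ c).source := by
      rw [← chart_eq]; exact mem_chart_source H y
    refine ((((compat (i y) j).comp' (h2.comp' h1)).congr_mono
      (s₁ := (e (i y) ≫ₕ c).source ∩ (e j).source) ?_ ?_).contMDiffAt
      (((e (i y) ≫ₕ c).open_source.inter (e j).open_source).mem_nhds
        ⟨hy', hy⟩)).contMDiffWithinAt
    · rintro x ⟨hx, hx'⟩
      simp only [mfld_simps] at hx
      simp [hx]
    · rintro x ⟨hx, hx'⟩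
      simp only [mfld_simps] at hx
      simp [hx, hx']
  · intro x hx
    set y := (e j).symm x
    set c := chartAt H (e (i y) y)
    have hc : c ∈ IsManifold.maximalAtlas I ∞ M :=
      IsManifold.subset_maximalAtlas (chart_mem_atlas H _)
    have h1 : ContMDiffOn I I ∞ (e (i y) ≫ₕ c).symm (e (i y) ≫ₕ c).target :=
      chart_eq y ▸ contMDiffOn_chart_symm
    have h2 : ContMDiffOn I I ∞ c c.source := contMDiffOn_of_mem_maximalAtlas hc
    have hy' : y ∈ (e (i y) ≫ₕ c).source := by
      rw [← chart_eq]; exact mem_chart_source H y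
    have hx' : x ∈ ((e j).symm ≫ₕ e (i y) ≫ₕ c).source := by
      simp only [mfld_simps] at hy' ⊢
      exact ⟨hx, hy'⟩
    refine (((h1.comp' (h2.comp' (compat j (i y)))).congr_mono
      (s₁ := ((e j).symm ≫ₕ e (i y) ≫ₕ c).source) ?_ ?_).contMDiffAt
      (((e j).symm ≫ₕ e (i y) ≫ₕ c).open_source.mem_nhds hx')).contMDiffWithinAt
    · intro x hx
      simp only [mfld_simps] at hx
      simp [hx]
    · intro x hx
      simp only [mfld_simps] at hx
      simp [hx]

end ManifoldConstruction

section Trivializations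

open Set

/-- A local trivialization, from a fibre coordinate and an inverse. -/
def Bundle.Trivialization.ofInverse {B F Y : Type*} [TopologicalSpace B] [TopologicalSpace F]
    [TopologicalSpace Y] (π : Y → B) (U : Set B) (hU : IsOpen U) (a : Y → F) (b : B × F → Y)
    (hπ : Continuous π) (ha : ContinuousOn a (π ⁻¹' U)) (hb : ContinuousOn b (U ×ˢ univ))
    (proj_b : ∀ x ∈ U, ∀ f, π (b (x, f)) = x) (a_b : ∀ x ∈ U, ∀ f, a (b (x, f)) = f)
    (b_a : ∀ y, π y ∈ U → b (π y, a y) = y) : Bundle.Trivialization F π where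
  toFun y := (π y, a y)
  invFun := b
  source := π ⁻¹' U
  target := U ×ˢ univ
  map_source' _ hy := ⟨hy, mem_univ _⟩
  map_target' := by
    rintro ⟨x, f⟩ ⟨hx, -⟩
    simpa [proj_b x hx f] using hx
  left_inv' y hy := b_a y hy
  right_inv' := by
    rintro ⟨x, f⟩ ⟨hx, -⟩
    exact Prod.ext (proj_b x hx f) (a_b x hx f)
  open_source := hU.preimage hπ
  open_target := hU.prod isOpen_univ
  continuousOn_toFun := hπ.continuousOn.prodMk ha
  continuousOn_invFun := hb
  baseSet := U
  open_baseSet := hU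
  source_eq := rfl
  target_eq := rfl
  proj_toFun _ _ := rfl

variable {K Q B : Type*} [TopologicalSpace K] [Group K] [TopologicalSpace Q] [TopologicalSpace B]
  {π : Q → B}

/-- The section of a principal bundle given by the unit element in a bundle chart. -/
noncomputable def Bundle.Trivialization.unitSection (e : Bundle.Trivialization K π)
    (b : B) : Q :=
  e.toOpenPartialHomeomorph.symm (b, 1)

theorem Bundle.Trivialization.apply_unitSection (e : Bundle.Trivialization K π) {b : B}
    (hb : b ∈ e.baseSet) : e (e.unitSection b) = (b, 1) :=
  e.apply_symm_apply (e.mem_target.2 hb)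

theorem Bundle.Trivialization.proj_unitSection (e : Bundle.Trivialization K π) {b : B}
    (hb : b ∈ e.baseSet) : π (e.unitSection b) = b :=
  e.proj_symm_apply (e.mem_target.2 hb)

theorem Bundle.Trivialization.unitSection_mem_source (e : Bundle.Trivialization K π)
    {b : B} (hb : b ∈ e.baseSet) : e.unitSection b ∈ e.source :=
  e.mem_source.2 ((e.proj_unitSection hb).symm ▸ hb)

end Trivializations

section SmoothSections

open Set

variable {EQ HQ EN HN EY HY : Type*}
  [NormedAddCommGroup EQ] [NormedSpace ℝ EQ] [TopologicalSpace HQ]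
  [NormedAddCommGroup EN] [NormedSpace ℝ EN] [TopologicalSpace HN]
  [NormedAddCommGroup EY] [NormedSpace ℝ EY] [TopologicalSpace HY]
  (IQ : ModelWithCorners ℝ EQ HQ) (IY : ModelWithCorners ℝ EY HY)
  {IN : ModelWithCorners ℝ EN HN}
  {Q N Y : Type*}
  [TopologicalSpace Q] [ChartedSpace HQ Q]
  [TopologicalSpace N] [ChartedSpace HN N]
  [TopologicalSpace Y] [ChartedSpace HY Y]

/-- Every point of `Y` has an open neighbourhood over which `m : Q → Y` has a smooth section. -/
def HasSmoothLocalSections (m : Q → Y) : Prop :=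
  ∀ y, ∃ (U : Set Y) (s : Y → Q), IsOpen U ∧ y ∈ U ∧ ContMDiffOn IY IQ ∞ s U ∧
    ∀ z ∈ U, m (s z) = z

namespace HasSmoothLocalSections

variable {IQ IY} {m : Q → Y}

theorem surjective (h : HasSmoothLocalSections IQ IY m) : Function.Surjective m := by
  intro y
  obtain ⟨U, s, -, hy, -, hs⟩ := h y
  exact ⟨s y, hs y hy⟩

theorem contMDiffOn (h : HasSmoothLocalSections IQ IY m) {f : Y → N} {S : Set Y}
    (hf : ContMDiffOn IQ IN ∞ (f ∘ m) (m ⁻¹' S)) : ContMDiffOn IY IN ∞ f S := by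
  intro y hy
  obtain ⟨U, s, hU, hyU, hs, hms⟩ := h y
  have h1 : ContMDiffOn IY IN ∞ f (U ∩ S) := by
    refine (hf.comp (hs.mono inter_subset_left) ?_).congr ?_
    · rintro z ⟨hz, hz'⟩
      simpa [hms z hz] using hz'
    · rintro z ⟨hz, -⟩
      simp [hms z hz]
  exact (h1 y ⟨hyU, hy⟩).mono_of_mem_nhdsWithin
    (Filter.inter_mem (mem_nhdsWithin_of_mem_nhds (hU.mem_nhds hyU)) self_mem_nhdsWithin)

theorem contMDiff (h : HasSmoothLocalSections IQ IY m) {f : Y → N}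
    (hf : ContMDiff IQ IN ∞ (f ∘ m)) : ContMDiff IY IN ∞ f := by
  rw [← contMDiffOn_univ]
  exact h.contMDiffOn hf.contMDiffOn

theorem comp {n : Y → N} (hn : HasSmoothLocalSections IY IN n)
    (hm : HasSmoothLocalSections IQ IY m) : HasSmoothLocalSections IQ IN (n ∘ m) := by
  intro x
  obtain ⟨U, s, hU, hxU, hs, hns⟩ := hn x
  obtain ⟨V, t, hV, hxV, ht, hmt⟩ := hm (s x)
  refine ⟨U ∩ s ⁻¹' V, t ∘ s, hs.continuousOn.isOpen_inter_preimage hU hV, ⟨hxU, hxV⟩,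
    ht.comp (hs.mono inter_subset_left) (fun z hz => hz.2), ?_⟩
  rintro z ⟨hz, hz'⟩
  simp [hmt _ hz', hns _ hz]

theorem of_comp {n : Y → N} (hm : ContMDiff IQ IY ∞ m)
    (h : HasSmoothLocalSections IQ IN (n ∘ m)) : HasSmoothLocalSections IY IN n := by
  intro x
  obtain ⟨U, s, hU, hxU, hs, hns⟩ := h x
  exact ⟨U, m ∘ s, hU, hxU, hm.comp_contMDiffOn hs, hns⟩

theorem prodMap_id {EF HF : Type*} [NormedAddCommGroup EF] [NormedSpace ℝ EF]
    [TopologicalSpace HF] {IF : ModelWithCorners ℝ EF HF} {F : Type*} [TopologicalSpace F]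
    [ChartedSpace HF F] (hm : HasSmoothLocalSections IQ IY m) :
    HasSmoothLocalSections (IF.prod IQ) (IF.prod IY) (Prod.map (id : F → F) m) := by
  rintro ⟨f, y⟩
  obtain ⟨U, s, hU, hyU, hs, hms⟩ := hm y
  refine ⟨univ ×ˢ U, Prod.map id s, isOpen_univ.prod hU, ⟨mem_univ _, hyU⟩,
    contMDiff_id.contMDiffOn.prodMap hs, ?_⟩
  rintro ⟨f', z⟩ ⟨-, hz⟩
  exact Prod.ext rfl (hms z hz)

end HasSmoothLocalSections

end SmoothSections

section Bundles

open Set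

variable {EK HK EQ HQ EB HB EF HF EY HY : Type*}
  [NormedAddCommGroup EK] [NormedSpace ℝ EK] [TopologicalSpace HK]
  [NormedAddCommGroup EQ] [NormedSpace ℝ EQ] [TopologicalSpace HQ]
  [NormedAddCommGroup EB] [NormedSpace ℝ EB] [TopologicalSpace HB]
  [NormedAddCommGroup EF] [NormedSpace ℝ EF] [TopologicalSpace HF]
  [NormedAddCommGroup EY] [NormedSpace ℝ EY] [TopologicalSpace HY]
  {IK : ModelWithCorners ℝ EK HK} {IQ : ModelWithCorners ℝ EQ HQ}
  {IB : ModelWithCorners ℝ EB HB} {IF : ModelWithCorners ℝ EF HF}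
  {IY : ModelWithCorners ℝ EY HY}
  {K Q B F Y : Type*}
  [TopologicalSpace K] [ChartedSpace HK K] [Group K]
  [TopologicalSpace Q] [ChartedSpace HQ Q] [MulAction Kᵐᵒᵖ Q]
  [TopologicalSpace B] [ChartedSpace HB B]

/-- The fibre coordinate `[q, f] ↦ (e q).2 • f` on an associated bundle which is induced by a bundle
chart `e` of the principal bundle. -/
theorem exists_inducedCoordinate {F Y : Type*} [MulAction K F] {π : Q → B}
    {e : Bundle.Trivialization K π} (he : IsPrincipalTrivialization IK IQ IB e)
    {πY : Y → B} {m : Q × F → Y}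
    (proj_map : ∀ a : Q × F, πY (m a) = π a.1) (map_surjective : Function.Surjective m)
    (map_eq_iff : ∀ a b : Q × F, m a = m b ↔ assocSetoid K Q F a b) :
    ∃ a : Y → F, ∀ q ∈ e.source, ∀ f : F, a (m (q, f)) = (e q).2 • f := by
  choose r hr using map_surjective
  refine ⟨fun y => (e (r y).1).2 • (r y).2, fun q hq f => ?_⟩
  obtain ⟨k, h1, h2⟩ := (map_eq_iff _ _).1 (hr (m (q, f)))
  have hq' : (r (m (q, f))).1 ∈ e.source := by
    rw [e.mem_source, ← proj_map, hr, proj_map]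
    exact e.mem_source.1 hq
  have h3 : f = k • (r (m (q, f))).2 := h2
  have h4 : (r (m (q, f))).1 = op k • q := h1
  change (e (r (m (q, f))).1).2 • (r (m (q, f))).2 = _
  rw [h4, he.map_smul q hq, mul_smul, ← h3]

variable [TopologicalSpace F] [ChartedSpace HF F] [MulAction K F]
  [TopologicalSpace Y] [ChartedSpace HY Y]

/-- A smooth local trivialization, from a smooth fibre coordinate and a smooth inverse. -/
theorem exists_isSmoothTrivialization {π : Y → B} {U : Set B} (hU : IsOpen U) {a : Y → F}
    {b : B × F → Y} (hπ : ContMDiff IY IB ∞ π) (ha : ContMDiffOn IY IF ∞ a (π ⁻¹' U))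
    (hb : ContMDiffOn (IB.prod IF) IY ∞ b (U ×ˢ univ))
    (proj_b : ∀ x ∈ U, ∀ f, π (b (x, f)) = x) (a_b : ∀ x ∈ U, ∀ f, a (b (x, f)) = f)
    (b_a : ∀ y, π y ∈ U → b (π y, a y) = y) :
    ∃ e : Bundle.Trivialization F π, e.baseSet = U ∧ (∀ y, e y = (π y, a y)) ∧
      IsSmoothTrivialization IB IF IY e :=
  ⟨.ofInverse π U hU a b hπ.continuous ha.continuousOn hb.continuousOn proj_b a_b b_a, rfl,
    fun _ => rfl, hπ.contMDiffOn.prodMk ha, hb⟩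

namespace IsPrincipalTrivialization

variable {π : Q → B} {e : Bundle.Trivialization K π}

theorem contMDiffOn_unitSection (he : IsPrincipalTrivialization IK IQ IB e) :
    ContMDiffOn IB IQ ∞ e.unitSection e.baseSet :=
  he.smooth.contMDiffOn_symm.comp (contMDiffOn_id.prodMk contMDiffOn_const)
    (fun _ hb => e.mem_target.2 hb)

theorem contMDiffOn_snd (he : IsPrincipalTrivialization IK IQ IB e) :
    ContMDiffOn IQ IK ∞ (fun q => (e q).2) e.source :=
  contMDiff_snd.comp_contMDiffOn he.smooth.contMDiffOn

end IsPrincipalTrivialization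

namespace IsPrincipalBundle

variable {π : Q → B}

theorem smul_unitSection (hπ : IsPrincipalBundle IK IQ IB K π) {e : Bundle.Trivialization K π}
    (he : IsPrincipalTrivialization IK IQ IB e) {q : Q} (hq : q ∈ e.source) :
    op (e q).2 • e.unitSection (π q) = q := by
  have hb := e.mem_source.1 hq
  have h1 : π (op (e q).2 • e.unitSection (π q)) = π q := by
    rw [hπ.proj_smul, e.proj_unitSection hb]
  have h2 : op (e q).2 • e.unitSection (π q) ∈ e.source := e.mem_source.2 (h1.symm ▸ hb)
  refine e.injOn h2 hq (show e _ = e _ from Prod.ext ?_ ?_)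
  · rw [e.coe_fst h2, e.coe_fst hq, h1]
  · rw [he.map_smul _ (e.unitSection_mem_source hb), e.apply_unitSection hb, one_mul]

theorem unitSection_rel {F : Type*} [MulAction K F] (hπ : IsPrincipalBundle IK IQ IB K π)
    {e : Bundle.Trivialization K π} (he : IsPrincipalTrivialization IK IQ IB e) {q : Q}
    (hq : q ∈ e.source) (f : F) :
    assocSetoid K Q F (e.unitSection (π q), (e q).2 • f) (q, f) := by
  refine ⟨(e q).2⁻¹, ?_, by simp⟩
  rw [MulOpposite.op_inv, eq_inv_smul_iff]
  exact hπ.smul_unitSection he hq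

theorem hasSmoothLocalSections (hπ : IsPrincipalBundle IK IQ IB K π) :
    HasSmoothLocalSections IQ IB π := by
  intro b
  obtain ⟨e, hb, he⟩ := hπ.exists_trivialization b
  exact ⟨e.baseSet, e.unitSection, e.open_baseSet, hb, he.contMDiffOn_unitSection,
    fun z hz => e.proj_unitSection hz⟩

end IsPrincipalBundle

theorem isAssociatedBundle_of_hasSmoothLocalSections {π : Q → B}
    (hπ : IsPrincipalBundle IK IQ IB K π) (hKF : ContMDiffSMul IK IF ∞ K F) {πY : Y → B}
    {m : Q × F → Y} (hm : ContMDiff (IQ.prod IF) IY ∞ m)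
    (hs : HasSmoothLocalSections (IQ.prod IF) IY m)
    (proj_map : ∀ a : Q × F, πY (m a) = π a.1)
    (map_eq_iff : ∀ a b : Q × F, m a = m b ↔ assocSetoid K Q F a b) :
    IsAssociatedBundle IK IQ IB IF IY K π πY m where
  isPrincipalBundle := hπ
  contMDiffSMul := hKF
  contMDiff_proj := hs.contMDiff ((hπ.contMDiff_proj.comp contMDiff_fst).congr proj_map)
  contMDiff_map := hm
  proj_map := proj_map
  map_surjective := hs.surjective
  map_eq_iff := map_eq_iff
  induced_trivialization e he := by
    obtain ⟨a, ha⟩ := exists_inducedCoordinate he proj_map hs.surjective map_eq_iff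
    have hπY : ContMDiff IY IB ∞ πY :=
      hs.contMDiff ((hπ.contMDiff_proj.comp contMDiff_fst).congr proj_map)
    have hmem : ∀ z : Q × F, πY (m z) ∈ e.baseSet → z.1 ∈ e.source := fun z hz => by
      rwa [e.mem_source, ← proj_map]
    have ha' : ContMDiffOn IY IF ∞ a (πY ⁻¹' e.baseSet) := by
      refine hs.contMDiffOn ?_
      have h1 : ContMDiffOn (IQ.prod IF) IF ∞ (fun z : Q × F => (e z.1).2 • z.2)
          (m ⁻¹' (πY ⁻¹' e.baseSet)) :=
        hKF.contMDiff_smul.comp_contMDiffOn (ContMDiffOn.prodMk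
          (he.contMDiffOn_snd.comp contMDiffOn_fst hmem) contMDiffOn_snd)
      exact h1.congr fun z hz => ha z.1 (hmem z hz) z.2
    have hb : ContMDiffOn (IB.prod IF) IY ∞ (fun z : B × F => m (e.unitSection z.1, z.2))
        (e.baseSet ×ˢ univ) :=
      hm.comp_contMDiffOn (ContMDiffOn.prodMk
        (he.contMDiffOn_unitSection.comp contMDiffOn_fst fun z hz => hz.1) contMDiffOn_snd)
    have proj_b : ∀ x ∈ e.baseSet, ∀ f, πY (m (e.unitSection x, f)) = x :=
      fun x hx f => (proj_map _).trans (e.proj_unitSection hx)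
    have a_b : ∀ x ∈ e.baseSet, ∀ f, a (m (e.unitSection x, f)) = f := fun x hx f => by
      rw [ha _ (e.unitSection_mem_source hx), e.apply_unitSection hx, one_smul]
    have b_a : ∀ y, πY y ∈ e.baseSet → m (e.unitSection (πY y), a y) = y := by
      intro y hy
      obtain ⟨⟨q, f⟩, rfl⟩ := hs.surjective y
      have hq : q ∈ e.source := hmem _ hy
      rw [ha q hq, proj_map]
      exact (map_eq_iff _ _).2 (hπ.unitSection_rel he hq f)
    obtain ⟨e', h1, h2, h3⟩ :=
      exists_isSmoothTrivialization e.open_baseSet hπY ha' hb proj_b a_b b_a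
    refine ⟨e', h1, h3, fun q hq f => ?_⟩
    rw [h2, proj_map, ha q hq]

theorem IsAssociatedBundle.hasSmoothLocalSections {π : Q → B} {πY : Y → B} {m : Q × F → Y}
    (h : IsAssociatedBundle IK IQ IB IF IY K π πY m) :
    HasSmoothLocalSections (IQ.prod IF) IY m := by
  intro y
  obtain ⟨e, hb, he⟩ := h.isPrincipalBundle.exists_trivialization (πY y)
  obtain ⟨e', h1, h2, h3⟩ := h.induced_trivialization e he
  have hsrc : ∀ z ∈ e'.source, πY z ∈ e.baseSet := fun z hz => h1 ▸ e'.mem_source.1 hz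
  refine ⟨e'.source, fun z => (e.unitSection (πY z), (e' z).2), e'.open_source,
    e'.mem_source.2 (h1.symm ▸ hb), ContMDiffOn.prodMk
      (he.contMDiffOn_unitSection.comp h.contMDiff_proj.contMDiffOn hsrc)
      (contMDiff_snd.comp_contMDiffOn h2.contMDiffOn), fun z hz => ?_⟩
  have hq := e.unitSection_mem_source (hsrc z hz)
  have hz' : m (e.unitSection (πY z), (e' z).2) ∈ e'.source := by
    rw [e'.mem_source, h.proj_map, e.proj_unitSection (hsrc z hz)]
    exact e'.mem_source.1 hz
  refine e'.injOn hz' hz (show e' _ = e' _ from ?_)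
  rw [h3 _ hq, e.apply_unitSection (hsrc z hz), one_smul, e.proj_unitSection (hsrc z hz),
    ← e'.coe_fst hz]

end Bundles

section AssociatedBundles

open Set

variable {EK HK EQ HQ EB HB EF HF : Type*}
  [NormedAddCommGroup EK] [NormedSpace ℝ EK] [TopologicalSpace HK]
  [NormedAddCommGroup EQ] [NormedSpace ℝ EQ] [TopologicalSpace HQ]
  [NormedAddCommGroup EB] [NormedSpace ℝ EB] [TopologicalSpace HB]
  [NormedAddCommGroup EF] [NormedSpace ℝ EF] [TopologicalSpace HF]
  {IK : ModelWithCorners ℝ EK HK} {IQ : ModelWithCorners ℝ EQ HQ}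
  {IB : ModelWithCorners ℝ EB HB} {IF : ModelWithCorners ℝ EF HF}
  {K Q B F Y : Type*}
  [TopologicalSpace K] [ChartedSpace HK K] [Group K]
  [TopologicalSpace Q] [ChartedSpace HQ Q] [MulAction Kᵐᵒᵖ Q]
  [TopologicalSpace B] [ChartedSpace HB B]
  [TopologicalSpace F] [ChartedSpace HF F] [MulAction K F]
  [TopologicalSpace Y]

/-- The induced bundle chart of `Y = (Q × F) / K`, as a topological space. -/
theorem IsPrincipalBundle.exists_inducedTrivialization {π : Q → B}
    (hπ : IsPrincipalBundle IK IQ IB K π) (hKF : ContMDiffSMul IK IF ∞ K F)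
    {πY : Y → B} {m : Q × F → Y} (hm : IsOpenQuotientMap m)
    (proj_map : ∀ a : Q × F, πY (m a) = π a.1)
    (map_eq_iff : ∀ a b : Q × F, m a = m b ↔ assocSetoid K Q F a b)
    {e : Bundle.Trivialization K π} (he : IsPrincipalTrivialization IK IQ IB e) :
    ∃ e' : Bundle.Trivialization F πY, e'.baseSet = e.baseSet ∧
      (∀ q ∈ e.source, ∀ f : F, e' (m (q, f)) = (π q, (e q).2 • f)) ∧
      ∀ z, e'.toOpenPartialHomeomorph.symm z = m (e.unitSection z.1, z.2) := by
  obtain ⟨a, ha⟩ := exists_inducedCoordinate he proj_map hm.surjective map_eq_iff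
  have hπY : Continuous πY :=
    hm.isQuotientMap.continuous_iff.2
      ((hπ.contMDiff_proj.continuous.comp continuous_fst).congr fun z => (proj_map z).symm)
  have hmem : ∀ z : Q × F, πY (m z) ∈ e.baseSet → z.1 ∈ e.source := fun z hz => by
    rwa [e.mem_source, ← proj_map]
  have ha' : ContinuousOn a (πY ⁻¹' e.baseSet) := by
    intro y hy
    obtain ⟨z, rfl⟩ := hm.surjective y
    refine ((hm.continuousAt_comp_iff).1 ?_).continuousWithinAt
    have h1 : ContinuousOn (fun z : Q × F => (e z.1).2 • z.2) (m ⁻¹' (πY ⁻¹' e.baseSet)) :=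
      hKF.contMDiff_smul.continuous.comp_continuousOn (ContinuousOn.prodMk
        (he.contMDiffOn_snd.continuousOn.comp continuousOn_fst hmem) continuousOn_snd)
    exact (h1.congr fun z hz => ha z.1 (hmem z hz) z.2).continuousAt
      (((e.open_baseSet.preimage hπY).preimage hm.continuous).mem_nhds hy)
  have hb : ContinuousOn (fun z : B × F => m (e.unitSection z.1, z.2)) (e.baseSet ×ˢ univ) :=
    hm.continuous.comp_continuousOn (ContinuousOn.prodMk
      (he.contMDiffOn_unitSection.continuousOn.comp continuousOn_fst fun z hz => hz.1)
      continuousOn_snd)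
  have proj_b : ∀ x ∈ e.baseSet, ∀ f, πY (m (e.unitSection x, f)) = x :=
    fun x hx f => (proj_map _).trans (e.proj_unitSection hx)
  have a_b : ∀ x ∈ e.baseSet, ∀ f, a (m (e.unitSection x, f)) = f := fun x hx f => by
    rw [ha _ (e.unitSection_mem_source hx), e.apply_unitSection hx, one_smul]
  have b_a : ∀ y, πY y ∈ e.baseSet → m (e.unitSection (πY y), a y) = y := by
    intro y hy
    obtain ⟨⟨q, f⟩, rfl⟩ := hm.surjective y
    have hq : q ∈ e.source := hmem _ hy
    rw [ha q hq, proj_map]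
    exact (map_eq_iff _ _).2 (hπ.unitSection_rel he hq f)
  refine ⟨.ofInverse πY e.baseSet e.open_baseSet a _ hπY ha' hb proj_b a_b b_a, rfl, ?_,
    fun _ => rfl⟩
  intro q hq f
  change (πY (m (q, f)), a (m (q, f))) = _
  rw [proj_map, ha q hq]

/-- The total space of a locally trivial map with Hausdorff base and fibre is Hausdorff. -/
theorem t2Space_of_trivialization [T2Space B] [T2Space F] {πY : Y → B} (hπY : Continuous πY)
    (h : ∀ b, ∃ e : Bundle.Trivialization F πY, b ∈ e.baseSet) : T2Space Y := by
  refine ⟨fun y z hyz => ?_⟩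
  by_cases hb : πY y = πY z
  · obtain ⟨e, he⟩ := h (πY y)
    have hy : y ∈ e.source := e.mem_source.2 he
    have hz : z ∈ e.source := e.mem_source.2 (hb ▸ he)
    obtain ⟨u, v, hu, hv, hyu, hzv, huv⟩ := t2_separation
      (fun heq => hyz (e.injOn hy hz heq) : e y ≠ e z)
    refine ⟨e.source ∩ e ⁻¹' u, e.source ∩ e ⁻¹' v, e.isOpen_inter_preimage hu,
      e.isOpen_inter_preimage hv, ⟨hy, hyu⟩, ⟨hz, hzv⟩, ?_⟩
    exact (huv.preimage e).mono inter_subset_right inter_subset_right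
  · obtain ⟨u, v, hu, hv, hyu, hzv, huv⟩ := t2_separation hb
    exact ⟨_, _, hu.preimage hπY, hv.preimage hπY, hyu, hzv, huv.preimage πY⟩

/-- The associated bundle: the quotient `Y` of `Q × F` by `K` carries a smooth structure for which
it is the bundle with typical fibre `F` associated with the principal bundle `Q → B`. -/
theorem IsPrincipalBundle.exists_isAssociatedBundle [IsManifold IB ∞ B] [IsManifold IF ∞ F]
    [T2Space B] [T2Space F] [SecondCountableTopology Q] [SecondCountableTopology F] {π : Q → B}
    (hπ : IsPrincipalBundle IK IQ IB K π) (hKF : ContMDiffSMul IK IF ∞ K F)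
    {πY : Y → B} {m : Q × F → Y} (hm : IsOpenQuotientMap m)
    (proj_map : ∀ a : Q × F, πY (m a) = π a.1)
    (map_eq_iff : ∀ a b : Q × F, m a = m b ↔ assocSetoid K Q F a b) :
    ∃ _ : ChartedSpace (ModelProd HB HF) Y, IsManifold (IB.prod IF) ∞ Y ∧ T2Space Y ∧
      SecondCountableTopology Y ∧ IsAssociatedBundle IK IQ IB IF (IB.prod IF) K π πY m := by
  choose e hbe he using hπ.exists_trivialization
  have h := fun b => hπ.exists_inducedTrivialization hKF hm proj_map map_eq_iff (he b)
  choose e' base_e' e'_map e'_symm using h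
  have hπY : Continuous πY :=
    hm.isQuotientMap.continuous_iff.2
      ((hπ.contMDiff_proj.continuous.comp continuous_fst).congr fun z => (proj_map z).symm)
  have hmem' : ∀ b (y : Y), y ∈ (e' b).source → πY y ∈ (e b).baseSet := fun b y hy => by
    rw [← base_e']
    exact (e' b).mem_source.1 hy
  obtain ⟨cs, hman, hsm⟩ := exists_chartedSpace_of_openPartialHomeomorph (IB.prod IF)
    (fun b => (e' b).toOpenPartialHomeomorph)
    (fun y => ⟨πY y, (e' _).mem_source.2 (by rw [base_e']; exact hbe _)⟩) (by
      intro i j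
      have hs : ∀ z ∈ ((e' i).toOpenPartialHomeomorph.symm ≫ₕ
          (e' j).toOpenPartialHomeomorph).source,
          z.1 ∈ (e i).baseSet ∧ (e i).unitSection z.1 ∈ (e j).source := by
        rintro z ⟨hz, hz'⟩
        have h1 : z.1 ∈ (e i).baseSet := base_e' i ▸ (e' i).mem_target.1 hz
        refine ⟨h1, ?_⟩
        have h2 := hmem' j _ hz'
        change πY ((e' i).toOpenPartialHomeomorph.symm z) ∈ _ at h2
        rwa [e'_symm, proj_map, ← (e j).mem_source] at h2
      have h1 : ContMDiffOn (IB.prod IF) (IB.prod IF) ∞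
          (fun z : B × F => (z.1, (e j ((e i).unitSection z.1)).2 • z.2))
          ((e' i).toOpenPartialHomeomorph.symm ≫ₕ (e' j).toOpenPartialHomeomorph).source :=
        contMDiffOn_fst.prodMk (hKF.contMDiff_smul.comp_contMDiffOn (ContMDiffOn.prodMk
          ((he j).contMDiffOn_snd.comp ((he i).contMDiffOn_unitSection.comp contMDiffOn_fst
            fun z hz => (hs z hz).1) fun z hz => (hs z hz).2) contMDiffOn_snd))
      refine h1.congr fun z hz => ?_
      change e' j ((e' i).toOpenPartialHomeomorph.symm z) = _
      rw [e'_symm, e'_map j _ (hs z hz).2, (e i).proj_unitSection (hs z hz).1])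
  have hm_smooth : ContMDiff (IQ.prod IF) (IB.prod IF) ∞ m := by
    intro z
    set b := π z.1
    have h1 : ContMDiffOn (IQ.prod IF) (IB.prod IF) ∞
        (fun z : Q × F => (π z.1, (e b z.1).2 • z.2)) ((e b).source ×ˢ univ) :=
      (hπ.contMDiff_proj.comp contMDiff_fst).contMDiffOn.prodMk
        (hKF.contMDiff_smul.comp_contMDiffOn (ContMDiffOn.prodMk
          ((he b).contMDiffOn_snd.comp contMDiffOn_fst fun z hz => hz.1) contMDiffOn_snd))
    refine (((hsm b).2.comp h1 ?_).congr ?_).contMDiffAt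
      (((e b).open_source.prod isOpen_univ).mem_nhds ⟨(e b).mem_source.2 (hbe b), mem_univ _⟩)
    · rintro z ⟨hz, -⟩
      refine (e' b).mem_target.2 ?_
      rw [base_e']
      exact (e b).mem_source.1 hz
    · rintro z ⟨hz, -⟩
      have h2 := (e' b).toOpenPartialHomeomorph.left_inv
        (show m z ∈ (e' b).source by
          rw [(e' b).mem_source, base_e', proj_map]
          exact (e b).mem_source.1 hz)
      change (e' b).toOpenPartialHomeomorph.symm (e' b (m z)) = m z at h2
      rw [e'_map b _ hz] at h2
      exact h2.symm
  have hsections : HasSmoothLocalSections (IQ.prod IF) (IB.prod IF) m := by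
    intro y
    set b := πY y
    refine ⟨(e' b).source, fun z => ((e b).unitSection (πY z), (e' b z).2), (e' b).open_source,
      (e' b).mem_source.2 (by rw [base_e']; exact hbe b), ContMDiffOn.prodMk
        ((he b).contMDiffOn_unitSection.comp
          ((contMDiff_fst.comp_contMDiffOn (hsm b).1).congr fun z hz => ((e' b).coe_fst hz).symm)
          (hmem' b))
        (contMDiff_snd.comp_contMDiffOn (hsm b).1), fun z hz => ?_⟩
    have h1 := (e' b).toOpenPartialHomeomorph.left_inv hz
    rw [e'_symm] at h1
    change m ((e b).unitSection (e' b z).1, (e' b z).2) = z at h1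
    rwa [(e' b).coe_fst hz] at h1
  exact ⟨cs, hman, t2Space_of_trivialization hπY fun b => ⟨e' b, base_e' b ▸ hbe b⟩,
    hm.isQuotientMap.secondCountableTopology hm.isOpenMap,
    isAssociatedBundle_of_hasSmoothLocalSections hπ hKF hm_smooth hsections proj_map map_eq_iff⟩

end AssociatedBundles

section InverseFunction

open Set

/-- The inverse function theorem, with a local inverse that is smooth on its whole domain. -/
theorem ContDiffOn.exists_openPartialHomeomorph {E F : Type*} [NormedAddCommGroup E]
    [NormedSpace ℝ E] [CompleteSpace E] [NormedAddCommGroup F] [NormedSpace ℝ F] {f : E → F}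
    {U : Set E} (hU : IsOpen U) (hf : ContDiffOn ℝ ∞ f U) {a : E} (ha : a ∈ U) {f' : E ≃L[ℝ] F}
    (hf' : HasFDerivAt f (f' : E →L[ℝ] F) a) :
    ∃ D : OpenPartialHomeomorph E F, a ∈ D.source ∧ D.source ⊆ U ∧ (∀ x, D x = f x) ∧
      ContDiffOn ℝ ∞ D.symm D.target := by
  have hfa : ContDiffAt ℝ ∞ f a := hf.contDiffAt (hU.mem_nhds ha)
  let D₀ := hfa.toOpenPartialHomeomorph f hf' (by simp)
  have hV : IsOpen (U ∩ fderiv ℝ f ⁻¹' range ((↑) : (E ≃L[ℝ] F) → E →L[ℝ] F)) :=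
    (hf.continuousOn_fderiv_of_isOpen hU (by simp)).isOpen_inter_preimage hU
      (ContinuousLinearEquiv.isOpen)
  refine ⟨D₀.restrOpen _ hV, ⟨hfa.mem_toOpenPartialHomeomorph_source hf' (by simp), ha, f',
    hf'.fderiv.symm⟩, fun x hx => hx.2.1, fun x => rfl, fun y hy => ?_⟩
  have hx : D₀.symm y ∈ U ∩ fderiv ℝ f ⁻¹' range ((↑) : (E ≃L[ℝ] F) → E →L[ℝ] F) :=
    ((D₀.restrOpen _ hV).map_target hy).2
  obtain ⟨hxU, g, hg⟩ := hx
  have h1 : ContDiffAt ℝ ∞ f (D₀.symm y) := hf.contDiffAt (hU.mem_nhds hxU)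
  have h2 : HasFDerivAt f (g : E →L[ℝ] F) (D₀.symm y) := by
    rw [hg]
    exact (h1.differentiableAt (by simp)).hasFDerivAt
  exact ((D₀.restrOpen _ hV).contDiffAt_symm hy h2 h1).contDiffWithinAt

/-- A map which fixes both axes through `(x₀, y₀)` pointwise near this point has the identity as its
derivative there. -/
theorem hasFDerivAt_id_of_eqOn_axes {E F : Type*} [NormedAddCommGroup E] [NormedSpace ℝ E]
    [NormedAddCommGroup F] [NormedSpace ℝ F] {f : E × F → E × F} {x₀ : E} {y₀ : F}
    (hf : DifferentiableAt ℝ f (x₀, y₀))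
    (hx : ∀ᶠ x in nhds x₀, f (x, y₀) = (x, y₀)) (hy : ∀ᶠ y in nhds y₀, f (x₀, y) = (x₀, y)) :
    HasFDerivAt f (ContinuousLinearEquiv.refl ℝ (E × F) : E × F →L[ℝ] E × F) (x₀, y₀) := by
  have h1 : (fderiv ℝ f (x₀, y₀)).comp (ContinuousLinearMap.inl ℝ E F) =
      ContinuousLinearMap.inl ℝ E F := by
    have h2 : HasFDerivAt (fun x => f (x, y₀)) _ x₀ :=
      hf.hasFDerivAt.comp x₀ (hasFDerivAt_prodMk_left x₀ y₀)
    exact h2.unique ((hasFDerivAt_prodMk_left x₀ y₀).congr_of_eventuallyEq hx)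
  have h3 : (fderiv ℝ f (x₀, y₀)).comp (ContinuousLinearMap.inr ℝ E F) =
      ContinuousLinearMap.inr ℝ E F := by
    have h2 : HasFDerivAt (fun y => f (x₀, y)) _ y₀ :=
      hf.hasFDerivAt.comp y₀ (hasFDerivAt_prodMk_right x₀ y₀)
    exact h2.unique ((hasFDerivAt_prodMk_right x₀ y₀).congr_of_eventuallyEq hy)
  convert! hf.hasFDerivAt using 1
  refine ContinuousLinearMap.ext fun ⟨u, v⟩ => ?_
  have h4 := DFunLike.congr_fun h1 u
  have h5 := DFunLike.congr_fun h3 v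
  have h6 : ((u, v) : E × F) = (u, 0) + (0, v) := by simp
  simp only [ContinuousLinearMap.comp_apply, ContinuousLinearMap.inl_apply,
    ContinuousLinearMap.inr_apply] at h4 h5
  rw [h6, map_add, map_add, h4, h5]
  rfl

end InverseFunction

section Slices

open Set

variable {EG EH F : Type*}
  [NormedAddCommGroup EG] [NormedSpace ℝ EG]
  [NormedAddCommGroup EH] [NormedSpace ℝ EH] [CompleteSpace EH]
  [NormedAddCommGroup F] [NormedSpace ℝ F] [CompleteSpace F]
  {G : Type*} [TopologicalSpace G] [ChartedSpace EG G] [Group G] [LieGroup 𝓘(ℝ, EG) ∞ G]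
  {H : Subgroup G} [ChartedSpace EH ↥H]

/-- A transversal `s` of an embedded subgroup `H` at the unit element: `(y, h) ↦ s y * h` is a
local diffeomorphism at `(0, 1)`. -/
theorem exists_local_transversal
    (h1 : Manifold.IsImmersionAtOfComplement F 𝓘(ℝ, EH) 𝓘(ℝ, EG) ∞ (Subtype.val : ↥H → G) 1)
    (hval : ContMDiff 𝓘(ℝ, EH) 𝓘(ℝ, EG) ∞ (Subtype.val : ↥H → G)) :
    ∃ (B : Set F) (O : Set ↥H) (W : Set G) (s : F → G) (r : G → F) (t : G → ↥H),
      IsOpen B ∧ 0 ∈ B ∧ IsOpen O ∧ 1 ∈ O ∧ IsOpen W ∧ s 0 = 1 ∧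
      ContMDiffOn 𝓘(ℝ, F) 𝓘(ℝ, EG) ∞ s B ∧ ContMDiffOn 𝓘(ℝ, EG) 𝓘(ℝ, F) ∞ r W ∧
      ContMDiffOn 𝓘(ℝ, EG) 𝓘(ℝ, EH) ∞ t W ∧
      (∀ y ∈ B, ∀ h ∈ O, s y * (h : G) ∈ W ∧ r (s y * h) = y ∧ t (s y * h) = h) ∧
      ∀ g ∈ W, r g ∈ B ∧ t g ∈ O ∧ s (r g) * (t g : G) = g := by
  set ψ := h1.domChart
  set φ := h1.codChart
  set A := h1.equiv
  have hφ1 : (1 : G) ∈ φ.source := h1.mem_codChart_source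
  have hψ1 : (1 : ↥H) ∈ ψ.source := h1.mem_domChart_source
  have hφψ : ∀ x ∈ ψ.target, φ (ψ.symm x : G) = A (x, 0) := by
    intro x hx
    have hx' : x ∈ (h1.domChart.extend 𝓘(ℝ, EH)).target := by simpa using hx
    simpa using h1.writtenInCharts hx'
  have hφ : ContMDiffOn 𝓘(ℝ, EG) 𝓘(ℝ, EG) ∞ φ φ.source :=
    contMDiffOn_of_mem_maximalAtlas h1.codChart_mem_maximalAtlas
  have hφs : ContMDiffOn 𝓘(ℝ, EG) 𝓘(ℝ, EG) ∞ φ.symm φ.target :=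
    contMDiffOn_symm_of_mem_maximalAtlas h1.codChart_mem_maximalAtlas
  have hψs : ContMDiffOn 𝓘(ℝ, EH) 𝓘(ℝ, EH) ∞ ψ.symm ψ.target :=
    contMDiffOn_symm_of_mem_maximalAtlas h1.domChart_mem_maximalAtlas
  set x₀ : EH := ψ 1
  have hx₀ : x₀ ∈ ψ.target := ψ.map_source hψ1
  have hψx₀ : ψ.symm x₀ = 1 := ψ.left_inv hψ1
  have hA : A (x₀, 0) = φ 1 := by
    rw [← hφψ x₀ hx₀, hψx₀]
    rfl
  set s : F → G := fun y => φ.symm (A (x₀, y))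
  have hs0 : s 0 = 1 := by
    change φ.symm (A (x₀, 0)) = 1
    rw [hA, φ.left_inv hφ1]
  set Bs : Set F := (fun y => A (x₀, y)) ⁻¹' φ.target
  have hAc : ContDiff ℝ ∞ (fun y : F => A (x₀, y)) :=
    A.contDiff.comp (contDiff_prodMk_right x₀)
  have hBs : IsOpen Bs := φ.open_target.preimage hAc.continuous
  have h0Bs : (0 : F) ∈ Bs := by
    change A (x₀, 0) ∈ φ.target
    rw [hA]
    exact φ.map_source hφ1
  have hs : ContMDiffOn 𝓘(ℝ, F) 𝓘(ℝ, EG) ∞ s Bs :=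
    hφs.comp hAc.contMDiff.contMDiffOn fun y hy => hy
  set p : EH × F → G := fun z => s z.2 * (ψ.symm z.1 : G)
  have hp : ContMDiffOn 𝓘(ℝ, EH × F) 𝓘(ℝ, EG) ∞ p (ψ.target ×ˢ Bs) :=
    (hs.comp contDiff_snd.contMDiff.contMDiffOn fun z hz => hz.2).mul
      (hval.comp_contMDiffOn (hψs.comp contDiff_fst.contMDiff.contMDiffOn fun z hz => hz.1))
  set U : Set (EH × F) := (ψ.target ×ˢ Bs) ∩ p ⁻¹' φ.source
  have hU : IsOpen U :=
    hp.continuousOn.isOpen_inter_preimage (ψ.open_target.prod hBs) φ.open_source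
  set Ψ : EH × F → EH × F := fun z => A.symm (φ (p z))
  have hΨ : ContDiffOn ℝ ∞ Ψ U := by
    rw [← contMDiffOn_iff_contDiffOn]
    exact A.symm.contDiff.contMDiff.comp_contMDiffOn
      (hφ.comp (hp.mono inter_subset_left) fun z hz => hz.2)
  have hx : ∀ x ∈ ψ.target, Ψ (x, 0) = (x, 0) := by
    intro x hx
    simp only [Ψ, p, hs0, one_mul, hφψ x hx, A.symm_apply_apply]
  have hy : ∀ y ∈ Bs, Ψ (x₀, y) = (x₀, y) := by
    intro y hy
    simp only [Ψ, p, hψx₀, OneMemClass.coe_one, mul_one, s]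
    rw [φ.right_inv hy, A.symm_apply_apply]
  have h0U : (x₀, (0 : F)) ∈ U := by
    refine ⟨⟨hx₀, h0Bs⟩, ?_⟩
    simp only [p, mem_preimage, hs0, hψx₀, OneMemClass.coe_one, mul_one]
    exact hφ1
  obtain ⟨D, hD0, hDU, hDΨ, hDs⟩ := hΨ.exists_openPartialHomeomorph hU h0U
    (hasFDerivAt_id_of_eqOn_axes ((hΨ.contDiffAt (hU.mem_nhds h0U)).differentiableAt (by simp))
      (Filter.eventually_of_mem (ψ.open_target.mem_nhds hx₀) hx)
      (Filter.eventually_of_mem (hBs.mem_nhds h0Bs) hy))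
  obtain ⟨N, B, hN, hB, hxN, h0B, hNB⟩ := isOpen_prod_iff.1 D.open_source _ _ hD0
  have hNψ : N ⊆ ψ.target := fun x hx => (hDU (hNB (mk_mem_prod hx h0B))).1.1
  have hBBs : B ⊆ Bs := fun y hy => (hDU (hNB (mk_mem_prod hxN hy))).1.2
  have hc : ContMDiffOn 𝓘(ℝ, EG) 𝓘(ℝ, EH × F) ∞ (fun g => A.symm (φ g)) φ.source :=
    A.symm.contDiff.contMDiff.comp_contMDiffOn hφ
  set W₁ : Set G := φ.source ∩ (fun g => A.symm (φ g)) ⁻¹' D.target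
  have hW₁ : IsOpen W₁ := hc.continuousOn.isOpen_inter_preimage φ.open_source D.open_target
  have hd : ContMDiffOn 𝓘(ℝ, EG) 𝓘(ℝ, EH × F) ∞ (fun g => D.symm (A.symm (φ g))) W₁ :=
    hDs.contMDiffOn.comp (hc.mono inter_subset_left) fun g hg => hg.2
  set W : Set G := W₁ ∩ (fun g => D.symm (A.symm (φ g))) ⁻¹' (N ×ˢ B)
  refine ⟨B, ψ.source ∩ ψ ⁻¹' N, W, s, fun g => (D.symm (A.symm (φ g))).2,
    fun g => ψ.symm (D.symm (A.symm (φ g))).1, hB, h0B, ψ.isOpen_inter_preimage hN, ⟨hψ1, hxN⟩,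
    hd.continuousOn.isOpen_inter_preimage hW₁ (hN.prod hB), hs0, hs.mono hBBs,
    contDiff_snd.contMDiff.comp_contMDiffOn (hd.mono inter_subset_left),
    hψs.comp (contDiff_fst.contMDiff.comp_contMDiffOn (hd.mono inter_subset_left))
      fun g hg => hNψ hg.2.1, ?_, ?_⟩
  · rintro y hy h ⟨hh, hhN⟩
    have hz : (ψ h, y) ∈ D.source := hNB (mk_mem_prod hhN hy)
    have hp' : p (ψ h, y) = s y * (h : G) := by
      simp only [p]
      rw [ψ.left_inv hh]
    have hzU := (hDU hz).2
    have h2 : A.symm (φ (s y * (h : G))) = D (ψ h, y) := by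
      rw [hDΨ, ← hp']
    have h3 : D.symm (A.symm (φ (s y * (h : G)))) = (ψ h, y) := by
      rw [h2, D.left_inv hz]
    refine ⟨⟨⟨hp' ▸ hzU, ?_⟩, ?_⟩, ?_, ?_⟩
    · rw [mem_preimage, h2]
      exact D.map_source hz
    · rw [mem_preimage, h3]
      exact mk_mem_prod hhN hy
    · exact congrArg Prod.snd h3
    · exact (congrArg (fun z => ψ.symm z.1) h3).trans (ψ.left_inv hh)
  · rintro g ⟨⟨hgφ, hgD⟩, hgN, hgB⟩
    refine ⟨hgB, ⟨ψ.map_target (hNψ hgN), ?_⟩, ?_⟩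
    · rw [mem_preimage, ψ.right_inv (hNψ hgN)]
      exact hgN
    · have hz := D.map_target hgD
      have h2 := D.right_inv hgD
      rw [hDΨ] at h2
      exact φ.injOn (hDU hz).2 hgφ (A.symm.injective h2)

/-- A slice of an embedded subgroup `H`: the set `{s y * h}` is open, and `(y, h)` are smooth
coordinates on it. -/
theorem exists_slice [LieGroup 𝓘(ℝ, EH) ∞ ↥H]
    (h1 : Manifold.IsImmersionAtOfComplement F 𝓘(ℝ, EH) 𝓘(ℝ, EG) ∞ (Subtype.val : ↥H → G) 1)
    (hval : ContMDiff 𝓘(ℝ, EH) 𝓘(ℝ, EG) ∞ (Subtype.val : ↥H → G)) :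
    ∃ (B : Set F) (W : Set G) (s : F → G) (r : G → F) (t : G → ↥H),
      IsOpen B ∧ 0 ∈ B ∧ IsOpen W ∧ s 0 = 1 ∧
      ContMDiffOn 𝓘(ℝ, F) 𝓘(ℝ, EG) ∞ s B ∧ ContMDiffOn 𝓘(ℝ, EG) 𝓘(ℝ, F) ∞ r W ∧
      ContMDiffOn 𝓘(ℝ, EG) 𝓘(ℝ, EH) ∞ t W ∧
      (∀ y ∈ B, ∀ h : ↥H, s y * (h : G) ∈ W ∧ r (s y * h) = y ∧ t (s y * h) = h) ∧
      ∀ g ∈ W, r g ∈ B ∧ s (r g) * (t g : G) = g := by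
  have : IsTopologicalGroup G := topologicalGroup_of_lieGroup 𝓘(ℝ, EG) ∞
  obtain ⟨B₀, O, W₀, s, r₀, t₀, hB₀, h0B₀, hO, h1O, hW₀, hs0, hs, hr₀, ht₀, hsW, hWs⟩ :=
    exists_local_transversal h1 hval
  obtain ⟨O', hO', rfl⟩ := isOpen_induced_iff.1 hO
  have hdiv : ContinuousOn (fun z : F × F => (s z.1)⁻¹ * s z.2) (B₀ ×ˢ B₀) :=
    ((hs.continuousOn.comp continuousOn_fst fun z hz => hz.1).inv).mul
      (hs.continuousOn.comp continuousOn_snd fun z hz => hz.2)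
  have hV := hdiv.isOpen_inter_preimage (hB₀.prod hB₀) hO'
  obtain ⟨B₁, B₂, hB₁, hB₂, h0B₁, h0B₂, hBB⟩ := isOpen_prod_iff.1 hV 0 0
    ⟨⟨h0B₀, h0B₀⟩, by simpa [hs0] using h1O⟩
  set B := B₁ ∩ B₂
  have hBsub : B ⊆ B₀ := fun y hy => (hBB (mk_mem_prod hy.1 h0B₂)).1.1
  have hinj : ∀ y ∈ B, ∀ y' ∈ B, ∀ h h' : ↥H, s y * (h : G) = s y' * h' → y = y' ∧ h = h' := by
    intro y hy y' hy' h h' heq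
    have h2 : (s y)⁻¹ * s y' = ((h * h'⁻¹ : ↥H) : G) := by
      rw [inv_mul_eq_iff_eq_mul, Subgroup.coe_mul, Subgroup.coe_inv, ← mul_assoc, heq]
      simp
    have h3 : (h * h'⁻¹ : ↥H) ∈ Subtype.val ⁻¹' O' := by
      have := (hBB (mk_mem_prod hy.1 hy'.2)).2
      rw [mem_preimage] at this ⊢
      rwa [← h2]
    have h4 := hsW y (hBsub hy) _ h3
    have h5 := hsW y' (hBsub hy') 1 h1O
    rw [← h2, mul_inv_cancel_left] at h4
    rw [OneMemClass.coe_one, mul_one] at h5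
    have h6 : y = y' := h4.2.1.symm.trans h5.2.1
    refine ⟨h6, ?_⟩
    rw [h6] at heq
    exact Subtype.ext (mul_left_cancel heq)
  set W : Set G := {g | ∃ y ∈ B, ∃ h : ↥H, s y * (h : G) = g}
  have hchoice : ∀ g : G, ∃ z : F × ↥H, g ∈ W → z.1 ∈ B ∧ s z.1 * (z.2 : G) = g := by
    intro g
    by_cases hg : g ∈ W
    · obtain ⟨y, hy, h, rfl⟩ := hg
      exact ⟨(y, h), fun _ => ⟨hy, rfl⟩⟩
    · exact ⟨(0, 1), fun h => absurd h hg⟩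
  choose ρ hρ using hchoice
  have hmemW : ∀ y ∈ B, ∀ h : ↥H, s y * (h : G) ∈ W := fun y hy h => ⟨y, hy, h, rfl⟩
  have hρs : ∀ y ∈ B, ∀ h : ↥H, ρ (s y * (h : G)) = (y, h) := by
    intro y hy h
    have h2 := hρ _ (hmemW y hy h)
    have h3 := hinj _ h2.1 _ hy _ _ h2.2
    exact Prod.ext h3.1 h3.2
  have hlocal : ∀ g ∈ W, ∃ N : Set G, IsOpen N ∧ g ∈ N ∧ N ⊆ W ∧
      ContMDiffOn 𝓘(ℝ, EG) 𝓘(ℝ, F) ∞ (fun g => (ρ g).1) N ∧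
      ContMDiffOn 𝓘(ℝ, EG) 𝓘(ℝ, EH) ∞ (fun g => (ρ g).2) N := by
    rintro _ ⟨y, hy, h, rfl⟩
    set τ : G → G := fun g => g * (h : G)⁻¹
    have hτ : ContMDiff 𝓘(ℝ, EG) 𝓘(ℝ, EG) ∞ τ := contMDiff_mul_right
    have hN₀ : IsOpen (W₀ ∩ r₀ ⁻¹' B) :=
      hr₀.continuousOn.isOpen_inter_preimage hW₀ (hB₁.inter hB₂)
    have key : ∀ g ∈ τ ⁻¹' (W₀ ∩ r₀ ⁻¹' B), s (r₀ (τ g)) * ((t₀ (τ g) * h : ↥H) : G) = g := by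
      rintro g ⟨hg, -⟩
      rw [Subgroup.coe_mul, ← mul_assoc, (hWs _ hg).2.2]
      simp [τ]
    have key' : ∀ g ∈ τ ⁻¹' (W₀ ∩ r₀ ⁻¹' B), ρ g = (r₀ (τ g), t₀ (τ g) * h) := by
      intro g hg
      conv_lhs => rw [← key g hg]
      exact hρs _ hg.2 _
    refine ⟨τ ⁻¹' (W₀ ∩ r₀ ⁻¹' B), hN₀.preimage hτ.continuous, ?_, ?_, ?_, ?_⟩
    · have h2 := hsW y (hBsub hy) 1 h1O
      rw [OneMemClass.coe_one, mul_one] at h2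
      simp only [τ, mem_preimage, mem_inter_iff, mul_inv_cancel_right]
      exact ⟨h2.1, h2.2.1.symm ▸ hy⟩
    · intro g hg
      exact ⟨_, hg.2, _, key g hg⟩
    · exact (hr₀.comp hτ.contMDiffOn fun g hg => hg.1).congr fun g hg => by rw [key' g hg]; rfl
    · exact ((ht₀.comp hτ.contMDiffOn fun g hg => hg.1).mul contMDiffOn_const).congr
        fun g hg => by rw [key' g hg]; rfl
  refine ⟨B, W, s, fun g => (ρ g).1, fun g => (ρ g).2, hB₁.inter hB₂, ⟨h0B₁, h0B₂⟩, ?_, hs0,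
    hs.mono hBsub, ?_, ?_, ?_, hρ⟩
  · refine isOpen_iff_forall_mem_open.2 fun g hg => ?_
    obtain ⟨N, hN, hgN, hNW, -, -⟩ := hlocal g hg
    exact ⟨N, hNW, hN, hgN⟩
  · intro g hg
    obtain ⟨N, hN, hgN, -, h2, -⟩ := hlocal g hg
    exact (h2.contMDiffAt (hN.mem_nhds hgN)).contMDiffWithinAt
  · intro g hg
    obtain ⟨N, hN, hgN, -, -, h2⟩ := hlocal g hg
    exact (h2.contMDiffAt (hN.mem_nhds hgN)).contMDiffWithinAt
  · intro y hy h
    exact ⟨hmemW y hy h, congrArg Prod.fst (hρs y hy h), congrArg Prod.snd (hρs y hy h)⟩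

end Slices

section HomogeneousSpace

open Set

variable {EG EH F : Type*}
  [NormedAddCommGroup EG] [NormedSpace ℝ EG]
  [NormedAddCommGroup EH] [NormedSpace ℝ EH] [CompleteSpace EH]
  [NormedAddCommGroup F] [NormedSpace ℝ F] [CompleteSpace F]
  {G : Type*} [TopologicalSpace G] [ChartedSpace EG G] [Group G] [LieGroup 𝓘(ℝ, EG) ∞ G]
  {H : Subgroup G} [ChartedSpace EH ↥H] [LieGroup 𝓘(ℝ, EH) ∞ ↥H]

/-- The quotient of a topological group by a closed subgroup is Hausdorff. -/
theorem QuotientGroup.t2Space_of_isClosed {G : Type*} [TopologicalSpace G] [Group G]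
    [IsTopologicalGroup G] {H : Subgroup G} (hH : IsClosed (H : Set G)) : T2Space (G ⧸ H) := by
  rw [t2Space_iff_of_isOpenQuotientMap QuotientGroup.isOpenQuotientMap_mk]
  simp only [QuotientGroup.eq]
  exact hH.preimage (continuous_fst.inv.mul continuous_snd)

/-- The homogeneous space `G / H`, as a manifold, and the principal bundle `G → G / H`. -/
theorem exists_homogeneousSpace
    (h1 : Manifold.IsImmersionAtOfComplement F 𝓘(ℝ, EH) 𝓘(ℝ, EG) ∞ (Subtype.val : ↥H → G) 1)
    (hval : ContMDiff 𝓘(ℝ, EH) 𝓘(ℝ, EG) ∞ (Subtype.val : ↥H → G)) :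
    ∃ _ : ChartedSpace F (G ⧸ H), IsManifold 𝓘(ℝ, F) ∞ (G ⧸ H) ∧
      IsPrincipalBundle 𝓘(ℝ, EH) 𝓘(ℝ, EG) 𝓘(ℝ, F) ↥H (QuotientGroup.mk : G → G ⧸ H) := by
  have : IsTopologicalGroup G := topologicalGroup_of_lieGroup 𝓘(ℝ, EG) ∞
  obtain ⟨B, W, s, r, t, hB, h0B, hW, hs0, hs, hr, ht, hsW, hWs⟩ := exists_slice h1 hval
  have hmk : IsOpenQuotientMap (QuotientGroup.mk : G → G ⧸ H) :=
    QuotientGroup.isOpenQuotientMap_mk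
  have h1W : (1 : G) ∈ W := by simpa [hs0] using (hsW 0 h0B 1).1
  have hinv : ∀ g ∈ W, ∀ h : ↥H, g * (h : G) ∈ W ∧ r (g * h) = r g ∧ t (g * h) = t g * h := by
    intro g hg h
    obtain ⟨h2, h3⟩ := hWs g hg
    have h4 := hsW (r g) h2 (t g * h)
    rwa [Subgroup.coe_mul, ← mul_assoc, h3] at h4
  have hL : ∀ g₀ : G, ContMDiff 𝓘(ℝ, EG) 𝓘(ℝ, EG) ∞ (fun g => g₀ * g) :=
    fun g₀ => contMDiff_mul_left
  have hchart : ∀ g₀ : G, ∃ e : OpenPartialHomeomorph (G ⧸ H) F, e.target = B ∧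
      (∀ g : G, (g : G ⧸ H) ∈ e.source ↔ g₀⁻¹ * g ∈ W) ∧
      (∀ g : G, g₀⁻¹ * g ∈ W → e g = r (g₀⁻¹ * g)) ∧
      ∀ y, e.symm y = QuotientGroup.mk (g₀ * s y) := by
    intro g₀
    have hmem : ∀ g : G, g₀⁻¹ * (g : G ⧸ H).out ∈ W ↔ g₀⁻¹ * g ∈ W := by
      intro g
      obtain ⟨h, hh⟩ := QuotientGroup.mk_out_eq_mul H g
      rw [hh, ← mul_assoc]
      refine ⟨fun h2 => ?_, fun h2 => (hinv _ h2 h).1⟩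
      have := (hinv _ h2 h⁻¹).1
      simpa using this
    have heq : ∀ g : G, g₀⁻¹ * g ∈ W → r (g₀⁻¹ * (g : G ⧸ H).out) = r (g₀⁻¹ * g) := by
      intro g hg
      obtain ⟨h, hh⟩ := QuotientGroup.mk_out_eq_mul H g
      rw [hh, ← mul_assoc, (hinv _ hg h).2.1]
    have hsrc : IsOpen {c : G ⧸ H | g₀⁻¹ * c.out ∈ W} := by
      rw [← hmk.isQuotientMap.isOpen_preimage]
      have : (QuotientGroup.mk : G → G ⧸ H) ⁻¹' {c : G ⧸ H | g₀⁻¹ * c.out ∈ W} =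
          (fun g => g₀⁻¹ * g) ⁻¹' W := by
        ext g
        exact hmem g
      rw [this]
      exact hW.preimage (continuous_const_mul _)
    refine ⟨{ toFun := fun c => r (g₀⁻¹ * c.out)
              invFun := fun y => QuotientGroup.mk (g₀ * s y)
              source := {c | g₀⁻¹ * c.out ∈ W}
              target := B
              map_source' := fun c hc => (hWs _ hc).1
              map_target' := fun y hy => ?_
              left_inv' := fun c hc => ?_
              right_inv' := fun y hy => ?_
              open_source := hsrc
              open_target := hB
              continuousOn_toFun := ?_
              continuousOn_invFun := ?_ }, rfl, hmem, heq, fun _ => rfl⟩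
    · have h2 := (hsW y hy 1).1
      rw [mem_ofPred_eq, hmem, inv_mul_cancel_left]
      simpa using h2
    · obtain ⟨g, rfl⟩ := hmk.surjective c
      have hg : g₀⁻¹ * g ∈ W := (hmem g).1 hc
      rw [heq g hg, QuotientGroup.eq]
      have h2 : g₀ * s (r (g₀⁻¹ * g)) = g * ((t (g₀⁻¹ * g))⁻¹ : ↥H) := by
        rw [Subgroup.coe_inv, eq_mul_inv_iff_mul_eq, mul_assoc, (hWs _ hg).2,
          mul_inv_cancel_left]
      rw [h2, mul_inv_rev, inv_mul_cancel_right]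
      exact H.inv_mem (t (g₀⁻¹ * g))⁻¹.2
    · have h2 := hsW y hy 1
      rw [OneMemClass.coe_one, mul_one] at h2
      rw [heq _ (by rw [inv_mul_cancel_left]; exact h2.1), inv_mul_cancel_left]
      exact h2.2.1
    · intro c hc
      obtain ⟨g, rfl⟩ := hmk.surjective c
      have hg : g₀⁻¹ * g ∈ W := (hmem g).1 hc
      refine (hmk.continuousAt_comp_iff.1 ?_).continuousWithinAt
      have h2 : ContinuousOn (fun g => r (g₀⁻¹ * g)) ((fun g => g₀⁻¹ * g) ⁻¹' W) :=
        hr.continuousOn.comp (continuous_const_mul _).continuousOn fun _ h => h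
      exact (h2.congr fun g hg => heq g hg).continuousAt
        ((hW.preimage (continuous_const_mul _)).mem_nhds hg)
    · exact hmk.continuous.comp_continuousOn (hs.continuousOn.const_mul _)
  choose e he_target he_source he_apply he_symm using hchart
  obtain ⟨cs, hman, hsm⟩ := exists_chartedSpace_of_openPartialHomeomorph 𝓘(ℝ, F) e
    (fun c => by
      obtain ⟨g, rfl⟩ := hmk.surjective c
      exact ⟨g, (he_source g g).2 (by rwa [inv_mul_cancel])⟩) (by
      intro i j
      have hsrc : ∀ y ∈ ((e i).symm ≫ₕ e j).source, y ∈ B ∧ j⁻¹ * (i * s y) ∈ W := by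
        rintro y ⟨hy, hy'⟩
        refine ⟨he_target i ▸ hy, ?_⟩
        change (e i).symm y ∈ (e j).source at hy'
        rwa [he_symm, he_source] at hy'
      have h2 : ContMDiffOn 𝓘(ℝ, F) 𝓘(ℝ, F) ∞ (fun y => r (j⁻¹ * (i * s y)))
          ((e i).symm ≫ₕ e j).source :=
        hr.comp ((hL j⁻¹).comp_contMDiffOn ((hL i).comp_contMDiffOn
          (hs.mono fun y hy => (hsrc y hy).1))) fun y hy => (hsrc y hy).2
      refine h2.congr fun y hy => ?_
      rw [Function.comp_apply, he_symm, he_apply j _ (hsrc y hy).2])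
  have hproj : ContMDiff 𝓘(ℝ, EG) 𝓘(ℝ, F) ∞ (QuotientGroup.mk : G → G ⧸ H) := by
    intro g
    have h2 : ContMDiffOn 𝓘(ℝ, EG) 𝓘(ℝ, F) ∞ (fun x => (e g).symm (r (g⁻¹ * x)))
        ((fun x => g⁻¹ * x) ⁻¹' W) :=
      (hsm g).2.comp (hr.comp (hL g⁻¹).contMDiffOn fun x hx => hx)
        fun x hx => by rw [he_target]; exact (hWs _ hx).1
    refine (h2.congr fun x hx => ?_).contMDiffAt
      ((hW.preimage (hL g⁻¹).continuous).mem_nhds (by simpa using h1W))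
    rw [← he_apply g x hx, (e g).left_inv ((he_source g x).2 hx)]
  refine ⟨cs, hman, ?_, hproj, quotientGroup_mk_smul H, fun c => ?_⟩
  · exact contMDiff_fst.mul (hval.comp contMDiff_snd)
  · obtain ⟨g₀, rfl⟩ := hmk.surjective c
    obtain ⟨τ, h2, h3, h4⟩ := exists_isSmoothTrivialization (IF := 𝓘(ℝ, EH)) (F := ↥H)
      (π := (QuotientGroup.mk : G → G ⧸ H)) (U := (e g₀).source) (e g₀).open_source
      (a := fun g => t (g₀⁻¹ * g)) (b := fun z => g₀ * (s (e g₀ z.1) * (z.2 : G))) hproj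
      (ht.comp (hL g₀⁻¹).contMDiffOn fun g hg => (he_source g₀ g).1 hg)
      ((hL g₀).comp_contMDiffOn ((hs.comp ((hsm g₀).1.comp contMDiffOn_fst fun z hz => hz.1)
        fun z hz => he_target g₀ ▸ (e g₀).map_source hz.1).mul
          (hval.comp_contMDiffOn contMDiffOn_snd)))
      (fun x hx h => by
        rw [← mul_assoc, QuotientGroup.mk_mul_of_mem _ h.2, ← he_symm, (e g₀).left_inv hx])
      (fun x hx h => by
        rw [inv_mul_cancel_left]
        exact (hsW _ (he_target g₀ ▸ (e g₀).map_source hx) h).2.2)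
      (fun g hg => by
        have h5 := (he_source g₀ g).1 hg
        simp only [he_apply g₀ g h5]
        rw [(hWs _ h5).2, mul_inv_cancel_left])
    refine ⟨τ, ?_, h4, fun q hq h => ?_⟩
    · rw [h2, he_source]
      simpa using h1W
    · rw [h3, h3]
      have hq' : g₀⁻¹ * q ∈ W := (he_source g₀ q).1 (h2 ▸ τ.mem_source.1 hq)
      change t (g₀⁻¹ * (q * h)) = t (g₀⁻¹ * q) * h
      rw [← mul_assoc, (hinv _ hq' h).2.2]

end HomogeneousSpace

section QuotientMaps

open Set

variable {K Q F : Type*} [Group K] [MulAction Kᵐᵒᵖ Q] [MulAction K F]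

theorem AssocSpace.mk_eq_iff {a b : Q × F} :
    AssocSpace.mk K a = AssocSpace.mk K b ↔ assocSetoid K Q F a b :=
  Quotient.eq

theorem AssocSpace.isOpenQuotientMap_mk [TopologicalSpace Q] [TopologicalSpace F]
    (hQ : ∀ k : K, Continuous fun q : Q => op k • q)
    (hF : ∀ k : K, Continuous fun f : F => k • f) :
    IsOpenQuotientMap (AssocSpace.mk K : Q × F → AssocSpace K Q F) := by
  refine ⟨Quotient.mk_surjective, continuous_quot_mk, fun U hU => ?_⟩
  have h1 : AssocSpace.mk K ⁻¹' (AssocSpace.mk K '' U) =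
      ⋃ k : K, (fun a : Q × F => (op k • a.1, k⁻¹ • a.2)) ⁻¹' U := by
    ext ⟨q, f⟩
    simp only [mem_preimage, mem_image, mem_iUnion]
    constructor
    · rintro ⟨⟨q', f'⟩, hU', h2⟩
      obtain ⟨k, h3, h4⟩ := AssocSpace.mk_eq_iff.1 h2
      refine ⟨k, ?_⟩
      dsimp only at h3 h4
      rw [← h3, h4, inv_smul_smul]
      exact hU'
    · rintro ⟨k, hk⟩
      exact ⟨_, hk, AssocSpace.mk_eq_iff.2 ⟨k, rfl, by simp⟩⟩
  change IsOpen (AssocSpace.mk K ⁻¹' (AssocSpace.mk K '' U))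
  rw [h1]
  exact isOpen_iUnion fun k =>
    hU.preimage (((hQ k).comp continuous_fst).prodMk ((hF k⁻¹).comp continuous_snd))

theorem RightQuotient.isOpenQuotientMap_mk [TopologicalSpace Q]
    (hQ : ∀ k : K, Continuous fun q : Q => op k • q) :
    IsOpenQuotientMap (RightQuotient.mk K : Q → RightQuotient K Q) := by
  have : ContinuousConstSMul Kᵐᵒᵖ Q := ⟨fun k => hQ k.unop⟩
  exact MulAction.isOpenQuotientMap_quotientMk

theorem isOpenQuotientMap_rightAction [TopologicalSpace K] [TopologicalSpace Q]
    (h : Continuous fun a : Q × K => op a.2 • a.1) :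
    IsOpenQuotientMap fun a : Q × K => op a.2 • a.1 := by
  have hk : ∀ k : K, Continuous fun q : Q => op k • q := fun k =>
    h.comp (continuous_id.prodMk continuous_const)
  refine ⟨fun q => ⟨(q, 1), by simp⟩, h, fun U hU => ?_⟩
  have h1 : (fun a : Q × K => op a.2 • a.1) '' U =
      ⋃ k : K, (fun q : Q => (op k⁻¹ • q, k)) ⁻¹' U := by
    ext q
    simp only [mem_image, mem_iUnion, mem_preimage]
    constructor
    · rintro ⟨⟨q', k⟩, hU', rfl⟩
      exact ⟨k, by simpa using hU'⟩
    · rintro ⟨k, hk⟩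
      exact ⟨_, hk, by simp⟩
  rw [h1]
  exact isOpen_iUnion fun k => hU.preimage ((hk k⁻¹).prodMk continuous_const)

end QuotientMaps

section Reduction

variable {G P : Type*} [Group G] [MulAction Gᵐᵒᵖ P] {H : Subgroup G}

theorem homogeneousMap_mk (p : P) (g : G) :
    homogeneousMap H (p, (g : G ⧸ H)) = RightQuotient.mk ↥H (op g • p) :=
  rfl

theorem RightQuotient.mk_eq_homogeneousMap (H : Subgroup G) (p : P) :
    RightQuotient.mk ↥H p = homogeneousMap H (p, ((1 : G) : G ⧸ H)) := by
  rw [homogeneousMap_mk, MulOpposite.op_one, one_smul]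

theorem RightQuotient.mk_eq_iff {K : Type*} [Group K] [MulAction Kᵐᵒᵖ P] {p q : P} :
    RightQuotient.mk K p = RightQuotient.mk K q ↔ ∃ k : K, p = op k • q := by
  refine Quotient.eq.trans ⟨?_, ?_⟩
  · rintro ⟨k, rfl⟩
    exact ⟨k.unop, rfl⟩
  · rintro ⟨k, rfl⟩
    exact ⟨op k, rfl⟩

theorem homogeneousMap_eq_iff (a b : P × (G ⧸ H)) :
    homogeneousMap H a = homogeneousMap H b ↔ assocSetoid G P (G ⧸ H) a b := by
  obtain ⟨p, c⟩ := a
  obtain ⟨p', c'⟩ := b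
  obtain ⟨g, rfl⟩ := QuotientGroup.mk_surjective c
  obtain ⟨g', rfl⟩ := QuotientGroup.mk_surjective c'
  rw [homogeneousMap_mk, homogeneousMap_mk, RightQuotient.mk_eq_iff]
  constructor
  · rintro ⟨h, hh⟩
    change op g • p = op (h : G) • op g' • p' at hh
    refine ⟨g' * h * g⁻¹, ?_, ?_⟩
    · change p = op (g' * h * g⁻¹) • p'
      rw [MulOpposite.op_mul, mul_smul, MulOpposite.op_mul, mul_smul, ← hh, ← mul_smul,
        ← MulOpposite.op_mul, mul_inv_cancel, MulOpposite.op_one, one_smul]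
    · change (g' : G ⧸ H) = ((g' * h * g⁻¹ * g : G) : G ⧸ H)
      rw [inv_mul_cancel_right, QuotientGroup.mk_mul_of_mem _ h.2]
  · rintro ⟨k, h1, h2⟩
    change p = op k • p' at h1
    change (g' : G ⧸ H) = ((k * g : G) : G ⧸ H) at h2
    rw [QuotientGroup.eq] at h2
    refine ⟨⟨_, h2⟩, ?_⟩
    change _ = op (g'⁻¹ * (k * g)) • op g' • p'
    rw [h1, ← mul_smul, ← mul_smul, ← MulOpposite.op_mul, ← MulOpposite.op_mul,
      mul_inv_cancel_left]

theorem compositeMap_eq_iff {V : Type*} [MulAction ↥H V] (a b : P × AssocSpace ↥H G V) :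
    compositeMap H V a = compositeMap H V b ↔ assocSetoid G P (AssocSpace ↥H G V) a b := by
  obtain ⟨p, w⟩ := a
  obtain ⟨p', w'⟩ := b
  obtain ⟨⟨g, v⟩, rfl⟩ := Quotient.mk_surjective w
  obtain ⟨⟨g', v'⟩, rfl⟩ := Quotient.mk_surjective w'
  change AssocSpace.mk ↥H (op g • p, v) = AssocSpace.mk ↥H (op g' • p', v') ↔ _
  rw [AssocSpace.mk_eq_iff]
  constructor
  · rintro ⟨h, hh, hv⟩
    change op g • p = op (h : G) • op g' • p' at hh
    refine ⟨g' * h * g⁻¹, ?_, ?_⟩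
    · change p = op (g' * h * g⁻¹) • p'
      rw [MulOpposite.op_mul, mul_smul, MulOpposite.op_mul, mul_smul, ← hh, ← mul_smul,
        ← MulOpposite.op_mul, mul_inv_cancel, MulOpposite.op_one, one_smul]
    · change AssocSpace.mk ↥H (g', v') = AssocSpace.mk ↥H (g' * h * g⁻¹ * g, v)
      rw [inv_mul_cancel_right, eq_comm, AssocSpace.mk_eq_iff]
      exact ⟨h, rfl, hv⟩
  · rintro ⟨k, h1, h2⟩
    change p = op k • p' at h1
    change AssocSpace.mk ↥H (g', v') = AssocSpace.mk ↥H (k * g, v) at h2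
    rw [eq_comm, AssocSpace.mk_eq_iff] at h2
    obtain ⟨h, h3, h4⟩ := h2
    change k * g = g' * h at h3
    refine ⟨h, ?_, h4⟩
    change op g • p = op (h : G) • op g' • p'
    rw [h1, ← mul_smul, ← mul_smul, ← MulOpposite.op_mul, ← MulOpposite.op_mul, h3]

variable [TopologicalSpace G] [TopologicalSpace P]

theorem isOpenQuotientMap_homogeneousMap [IsTopologicalGroup G]
    (h : Continuous fun a : P × G => op a.2 • a.1) :
    IsOpenQuotientMap (homogeneousMap H : P × (G ⧸ H) → RightQuotient ↥H P) := by
  have h1 : IsOpenQuotientMap (Prod.map id QuotientGroup.mk : P × G → P × (G ⧸ H)) :=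
    IsOpenQuotientMap.id.prodMap QuotientGroup.isOpenQuotientMap_mk
  refine h1.of_comp_iff.1 ?_
  exact (RightQuotient.isOpenQuotientMap_mk (K := ↥H) fun k =>
    h.comp (continuous_id.prodMk continuous_const)).comp (isOpenQuotientMap_rightAction h)

theorem isOpenQuotientMap_compositeMap [IsTopologicalGroup G] {V : Type*} [TopologicalSpace V]
    [MulAction ↥H V] (h : Continuous fun a : P × G => op a.2 • a.1)
    (hV : ∀ k : ↥H, Continuous fun v : V => k • v) :
    IsOpenQuotientMap (compositeMap H V : P × AssocSpace ↥H G V → AssocSpace ↥H P V) := by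
  have h1 : IsOpenQuotientMap
      (Prod.map id (AssocSpace.mk ↥H) : P × (G × V) → P × AssocSpace ↥H G V) :=
    IsOpenQuotientMap.id.prodMap (AssocSpace.isOpenQuotientMap_mk
      (fun k => continuous_mul_const (k : G)) hV)
  refine h1.of_comp_iff.1 ?_
  exact (AssocSpace.isOpenQuotientMap_mk (K := ↥H)
    (fun k => h.comp (continuous_id.prodMk continuous_const)) hV).comp
      (((isOpenQuotientMap_rightAction h).prodMap IsOpenQuotientMap.id).comp
        (Homeomorph.prodAssoc P G V).symm.isOpenQuotientMap)

end Reduction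

section Reduction

open Set

variable {EG HG EH HH EP HP EX HX EQ HQ ES HS EV HV EW HW EY HY : Type*}
  [NormedAddCommGroup EG] [NormedSpace ℝ EG] [TopologicalSpace HG]
  [NormedAddCommGroup EH] [NormedSpace ℝ EH] [TopologicalSpace HH]
  [NormedAddCommGroup EP] [NormedSpace ℝ EP] [TopologicalSpace HP]
  [NormedAddCommGroup EX] [NormedSpace ℝ EX] [TopologicalSpace HX]
  [NormedAddCommGroup EQ] [NormedSpace ℝ EQ] [TopologicalSpace HQ]
  [NormedAddCommGroup ES] [NormedSpace ℝ ES] [TopologicalSpace HS]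
  [NormedAddCommGroup EV] [NormedSpace ℝ EV] [TopologicalSpace HV]
  [NormedAddCommGroup EW] [NormedSpace ℝ EW] [TopologicalSpace HW]
  [NormedAddCommGroup EY] [NormedSpace ℝ EY] [TopologicalSpace HY]
  {IG : ModelWithCorners ℝ EG HG} {IH : ModelWithCorners ℝ EH HH}
  {IP : ModelWithCorners ℝ EP HP} {IX : ModelWithCorners ℝ EX HX}
  {IQ : ModelWithCorners ℝ EQ HQ} {IS : ModelWithCorners ℝ ES HS}
  {IV : ModelWithCorners ℝ EV HV} {IW : ModelWithCorners ℝ EW HW}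
  {IY : ModelWithCorners ℝ EY HY}
  {G P X V : Type*}
  [TopologicalSpace G] [ChartedSpace HG G] [Group G]
  {H : Subgroup G} [ChartedSpace HH ↥H]

theorem contMDiffSMul_quotient [ChartedSpace HQ (G ⧸ H)] [ContMDiffMul IG ∞ G]
    (hGH : IsPrincipalBundle IH IG IQ ↥H (QuotientGroup.mk : G → G ⧸ H)) :
    ContMDiffSMul IG IQ ∞ G (G ⧸ H) where
  contMDiff_smul := by
    refine (hGH.hasSmoothLocalSections.prodMap_id (F := G) (IF := IG)).contMDiff ?_
    exact hGH.contMDiff_proj.comp (contMDiff_fst.mul contMDiff_snd)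

theorem contMDiffSMul_inducedAction [TopologicalSpace V] [ChartedSpace HV V] [MulAction ↥H V]
    [ChartedSpace HQ (G ⧸ H)] [ChartedSpace HW (AssocSpace ↥H G V)] [ContMDiffMul IG ∞ G]
    (hW : IsAssociatedBundle IH IG IQ IV IW ↥H (QuotientGroup.mk : G → G ⧸ H)
      (inducedProj H V) (AssocSpace.mk ↥H)) :
    ContMDiffSMul IG IW ∞ G (AssocSpace ↥H G V) where
  contMDiff_smul := by
    refine (hW.hasSmoothLocalSections.prodMap_id (F := G) (IF := IG)).contMDiff ?_
    exact hW.contMDiff_map.comp ((contMDiff_fst.mul (contMDiff_fst.comp contMDiff_snd)).prodMk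
      (contMDiff_snd.comp contMDiff_snd))

variable [TopologicalSpace P] [ChartedSpace HP P] [MulAction Gᵐᵒᵖ P]
  [TopologicalSpace X] [ChartedSpace HX X] {π : P → X}
  [ChartedSpace HQ (G ⧸ H)] [ChartedSpace HS (RightQuotient ↥H P)]

/-- `P → P / H` is a principal bundle with structure group `H`. -/
theorem isPrincipalBundle_rightQuotient (hval : ContMDiff IH IG ∞ (Subtype.val : ↥H → G))
    (hπ : IsPrincipalBundle IG IP IX G π)
    (hGH : IsPrincipalBundle IH IG IQ ↥H (QuotientGroup.mk : G → G ⧸ H))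
    (hS : IsAssociatedBundle IG IP IX IQ IS G π (RightQuotient.proj H π hπ.proj_smul)
      (homogeneousMap H)) :
    IsPrincipalBundle IH IP IS ↥H (RightQuotient.mk ↥H : P → RightQuotient ↥H P) := by
  have hmk : ContMDiff IP IS ∞ (RightQuotient.mk ↥H : P → RightQuotient ↥H P) :=
    (hS.contMDiff_map.comp (contMDiff_id.prodMk contMDiff_const)).congr
      (RightQuotient.mk_eq_homogeneousMap H)
  refine ⟨hπ.contMDiff_smul.comp (contMDiff_fst.prodMk (hval.comp contMDiff_snd)), hmk,
    RightQuotient.mk_smul, fun σ => ?_⟩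
  obtain ⟨p₀, rfl⟩ : ∃ p₀, RightQuotient.mk ↥H p₀ = σ := Quotient.mk_surjective σ
  obtain ⟨e, hp₀, he⟩ := hπ.exists_trivialization (π p₀)
  obtain ⟨e', base_e', he', e'_map⟩ := hS.induced_trivialization e he
  obtain ⟨τ, hg₀, hτ⟩ := hGH.exists_trivialization ((e p₀).2 : G ⧸ H)
  have e'_mk : ∀ p ∈ e.source, e' (RightQuotient.mk ↥H p) = (π p, ((e p).2 : G ⧸ H)) := by
    intro p hp
    rw [RightQuotient.mk_eq_homogeneousMap, e'_map p hp]
    exact Prod.ext rfl (congrArg QuotientGroup.mk (mul_one _))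
  have mem_e' : ∀ p : P, RightQuotient.mk ↥H p ∈ e'.source ↔ p ∈ e.source := by
    intro p
    rw [e'.mem_source, e.mem_source, base_e']
    rfl
  set U : Set (RightQuotient ↥H P) := e'.source ∩ e' ⁻¹' (univ ×ˢ τ.baseSet)
  have hU : IsOpen U := e'.isOpen_inter_preimage (isOpen_univ.prod τ.open_baseSet)
  have memU : ∀ p : P, RightQuotient.mk ↥H p ∈ U ↔ p ∈ e.source ∧ (e p).2 ∈ τ.source := by
    intro p
    refine (and_congr_left' (mem_e' p)).trans (and_congr_right fun hp => ?_)
    rw [mem_preimage, e'_mk p hp, τ.mem_source]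
    exact ⟨fun h => h.2, fun h => ⟨mem_univ _, h⟩⟩
  have he'1 : ContMDiffOn IS (IX.prod IQ) ∞ e' U := he'.contMDiffOn.mono inter_subset_left
  have hτt : ∀ z ∈ U ×ˢ (univ : Set ↥H), ((e' z.1).2, z.2) ∈ τ.target :=
    fun z hz => τ.mem_target.2 hz.1.2.2
  have het : ∀ z ∈ U ×ˢ (univ : Set ↥H), ∀ g : G, ((e' z.1).1, g) ∈ e.target := by
    intro z hz g
    rw [e.mem_target, ← base_e', e'.coe_fst hz.1.1]
    exact e'.mem_source.1 hz.1.1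
  have hb : ContMDiffOn (IS.prod IH) IP ∞ (fun z : RightQuotient ↥H P × ↥H =>
      e.toOpenPartialHomeomorph.symm
        ((e' z.1).1, τ.toOpenPartialHomeomorph.symm ((e' z.1).2, z.2))) (U ×ˢ univ) := by
    have h1 : ContMDiffOn (IS.prod IH) (IX.prod IQ) ∞
        (fun z : RightQuotient ↥H P × ↥H => e' z.1) (U ×ˢ univ) :=
      he'1.comp contMDiffOn_fst fun z hz => hz.1
    exact he.smooth.contMDiffOn_symm.comp ((contMDiff_fst.comp_contMDiffOn h1).prodMk
      (hτ.smooth.contMDiffOn_symm.comp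
        ((contMDiff_snd.comp_contMDiffOn h1).prodMk contMDiffOn_snd) hτt))
      fun z hz => het z hz _
  have ha : ContMDiffOn IP IH ∞ (fun p : P => (τ (e p).2).2) (RightQuotient.mk ↥H ⁻¹' U) :=
    hτ.contMDiffOn_snd.comp (he.contMDiffOn_snd.mono fun p hp => ((memU p).1 hp).1)
      fun p hp => ((memU p).1 hp).2
  have e_b : ∀ σ ∈ U, ∀ h : ↥H, e (e.toOpenPartialHomeomorph.symm
        ((e' σ).1, τ.toOpenPartialHomeomorph.symm ((e' σ).2, h))) =
      ((e' σ).1, τ.toOpenPartialHomeomorph.symm ((e' σ).2, h)) := fun σ hσ h =>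
    e.apply_symm_apply (het (σ, h) ⟨hσ, mem_univ _⟩ _)
  obtain ⟨e₁, h1, h2, h3⟩ := exists_isSmoothTrivialization hU hmk ha hb
    (fun σ hσ h => by
      have h4 := e.map_target (het (σ, h) ⟨hσ, mem_univ _⟩
        (τ.toOpenPartialHomeomorph.symm ((e' σ).2, h)))
      refine e'.injOn ((mem_e' _).2 h4) hσ.1 (show e' _ = e' _ from ?_)
      rw [e'_mk _ h4, e_b σ hσ h]
      refine Prod.ext ?_ (τ.proj_symm_apply (hτt (σ, h) ⟨hσ, mem_univ _⟩))
      exact e.proj_symm_apply (het (σ, h) ⟨hσ, mem_univ _⟩ _))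
    (fun σ hσ h => by
      rw [e_b σ hσ h]
      exact congrArg Prod.snd (τ.apply_symm_apply (hτt (σ, h) ⟨hσ, mem_univ _⟩)))
    (fun p hp => by
      obtain ⟨h4, h5⟩ := (memU p).1 hp
      have h6 : ((((e p).2 : G) : G ⧸ H), (τ (e p).2).2) = τ (e p).2 :=
        Prod.ext (τ.coe_fst h5).symm rfl
      have h7 : τ.toOpenPartialHomeomorph.symm (τ (e p).2) = (e p).2 :=
        τ.toOpenPartialHomeomorph.left_inv h5
      have h8 : (π p, (e p).2) = e p := Prod.ext (e.coe_fst h4).symm rfl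
      simp only [e'_mk p h4, h6, h7, h8]
      exact e.toOpenPartialHomeomorph.left_inv h4)
  refine ⟨e₁, ?_, h3, fun p hp h => ?_⟩
  · rw [h1, memU, e.mem_source, τ.mem_source]
    exact ⟨hp₀, hg₀⟩
  · have h4 := (memU p).1 (h1 ▸ e₁.mem_source.1 hp)
    rw [h2, h2]
    change (τ (e (op (h : G) • p)).2).2 = (τ (e p).2).2 * h
    rw [he.map_smul p h4.1]
    exact hτ.map_smul _ h4.2 h

/-- `Y = (P × V) / H` is associated with `P → P / H`, once it is associated with `P → X`. -/
theorem isAssociatedBundle_rightQuotient [TopologicalSpace V] [ChartedSpace HV V] [MulAction ↥H V]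
    [ChartedSpace HW (AssocSpace ↥H G V)] [ChartedSpace HY (AssocSpace ↥H P V)]
    {πY : AssocSpace ↥H P V → X}
    (hπ : IsPrincipalBundle IG IP IX G π)
    (hPH : IsPrincipalBundle IH IP IS ↥H (RightQuotient.mk ↥H : P → RightQuotient ↥H P))
    (hHV : ContMDiffSMul IH IV ∞ ↥H V)
    (hW : IsAssociatedBundle IH IG IQ IV IW ↥H (QuotientGroup.mk : G → G ⧸ H)
      (inducedProj H V) (AssocSpace.mk ↥H))
    (hY : IsAssociatedBundle IG IP IX IW IY G π πY (compositeMap H V)) :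
    IsAssociatedBundle IH IP IS IV IY ↥H (RightQuotient.mk ↥H : P → RightQuotient ↥H P)
      (compositeProj H V) (AssocSpace.mk ↥H) := by
  have hact : ContMDiff (IP.prod (IG.prod IV)) (IP.prod IV) ∞
      (fun a : P × (G × V) => (op a.2.1 • a.1, a.2.2)) :=
    (hπ.contMDiff_smul.comp (contMDiff_fst.prodMk (contMDiff_fst.comp contMDiff_snd))).prodMk
      (contMDiff_snd.comp contMDiff_snd)
  refine isAssociatedBundle_of_hasSmoothLocalSections hPH hHV ?_ ?_ (fun _ => rfl)
    (fun _ _ => AssocSpace.mk_eq_iff)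
  · have h1 : ContMDiff (IP.prod IV) (IP.prod IW) ∞
        (fun a : P × V => (a.1, AssocSpace.mk ↥H ((1 : G), a.2))) :=
      contMDiff_fst.prodMk (hW.contMDiff_map.comp (contMDiff_const.prodMk contMDiff_snd))
    refine (hY.contMDiff_map.comp h1).congr fun a => ?_
    change _ = AssocSpace.mk ↥H (op (1 : G) • a.1, a.2)
    rw [MulOpposite.op_one, one_smul]
  · exact HasSmoothLocalSections.of_comp hact
      (hY.hasSmoothLocalSections.comp hW.hasSmoothLocalSections.prodMap_id)

end Reduction

/-- The associated bundle, for manifolds without boundary. -/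
theorem IsPrincipalBundle.exists_isAssociatedBundle_self {EK EQ EB EF : Type*}
    [NormedAddCommGroup EK] [NormedSpace ℝ EK] [NormedAddCommGroup EQ] [NormedSpace ℝ EQ]
    [NormedAddCommGroup EB] [NormedSpace ℝ EB] [NormedAddCommGroup EF] [NormedSpace ℝ EF]
    {K Q B F Y : Type*} [TopologicalSpace K] [ChartedSpace EK K] [Group K]
    [TopologicalSpace Q] [ChartedSpace EQ Q] [MulAction Kᵐᵒᵖ Q]
    [TopologicalSpace B] [ChartedSpace EB B] [TopologicalSpace F] [ChartedSpace EF F]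
    [MulAction K F] [TopologicalSpace Y] (hQ : IsSmoothManifold EQ Q)
    (hB : IsSmoothManifold EB B) (hF : IsSmoothManifold EF F) {π : Q → B}
    (hπ : IsPrincipalBundle 𝓘(ℝ, EK) 𝓘(ℝ, EQ) 𝓘(ℝ, EB) K π)
    (hKF : ContMDiffSMul 𝓘(ℝ, EK) 𝓘(ℝ, EF) ∞ K F) {πY : Y → B} {m : Q × F → Y}
    (hm : IsOpenQuotientMap m) (proj_map : ∀ a : Q × F, πY (m a) = π a.1)
    (map_eq_iff : ∀ a b : Q × F, m a = m b ↔ assocSetoid K Q F a b) :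
    ∃ _ : ChartedSpace (EB × EF) Y, IsSmoothManifold (EB × EF) Y ∧
      IsAssociatedBundle 𝓘(ℝ, EK) 𝓘(ℝ, EQ) 𝓘(ℝ, EB) 𝓘(ℝ, EF) 𝓘(ℝ, EB × EF) K π πY m := by
  have := hB.isManifold
  have := hB.t2Space
  have := hF.isManifold
  have := hF.t2Space
  have := hF.secondCountableTopology
  have := hQ.secondCountableTopology
  obtain ⟨cs, h1, h2, h3, h4⟩ := hπ.exists_isAssociatedBundle hKF hm proj_map map_eq_iff
  rw [← modelWithCornersSelf_prod] at h1 h4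
  let cs' : ChartedSpace (EB × EF) Y := cs
  exact ⟨cs', ⟨h1, h2, h3⟩, h4⟩

theorem theorem2
    {EG EH EP EX EV : Type*}
    [NormedAddCommGroup EG] [NormedSpace ℝ EG] [FiniteDimensional ℝ EG]
    [NormedAddCommGroup EH] [NormedSpace ℝ EH] [FiniteDimensional ℝ EH]
    [NormedAddCommGroup EP] [NormedSpace ℝ EP] [FiniteDimensional ℝ EP]
    [NormedAddCommGroup EX] [NormedSpace ℝ EX] [FiniteDimensional ℝ EX]
    [NormedAddCommGroup EV] [NormedSpace ℝ EV] [FiniteDimensional ℝ EV]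
    -- the structure Lie group `G`
    {G : Type*} [TopologicalSpace G] [ChartedSpace EG G] [Group G] [LieGroup 𝓘(ℝ, EG) ∞ G]
    (hG : IsSmoothManifold EG G)
    -- the closed subgroup `H`, with its structure of an embedded Lie subgroup
    (H : Subgroup G) (hH : IsClosed (H : Set G)) [ChartedSpace EH ↥H] [LieGroup 𝓘(ℝ, EH) ∞ ↥H]
    (hHG : Manifold.IsSmoothEmbedding 𝓘(ℝ, EH) 𝓘(ℝ, EG) ∞ (Subtype.val : ↥H → G))
    -- the principal bundle `π : P → X` with structure group `G`
    {P X : Type*} [TopologicalSpace P] [ChartedSpace EP P] [TopologicalSpace X] [ChartedSpace EX X]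
    (hP : IsSmoothManifold EP P) (hX : IsSmoothManifold EX X) [MulAction Gᵐᵒᵖ P]
    (π : P → X) (hπ : IsPrincipalBundle 𝓘(ℝ, EG) 𝓘(ℝ, EP) 𝓘(ℝ, EX) G π)
    -- the manifold `V`, with a smooth left action of `H`
    {V : Type*} [TopologicalSpace V] [ChartedSpace EV V] (hV : IsSmoothManifold EV V)
    [MulAction ↥H V] (hHV : ContMDiffSMul 𝓘(ℝ, EH) 𝓘(ℝ, EV) ∞ ↥H V) :
    -- smooth structures on `G / H`, `W = (G × V) / H`, `P / H` and `Y = (P × V) / H`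
    ∃ (k : ℕ)
      (_ : ChartedSpace (EuclideanSpace ℝ (Fin k)) (G ⧸ H))
      (_ : ChartedSpace (EuclideanSpace ℝ (Fin k) × EV) (AssocSpace ↥H G V))
      (_ : ChartedSpace (EX × EuclideanSpace ℝ (Fin k)) (RightQuotient ↥H P))
      (_ : ChartedSpace (EX × EuclideanSpace ℝ (Fin k) × EV) (AssocSpace ↥H P V)),
      IsSmoothManifold (EuclideanSpace ℝ (Fin k)) (G ⧸ H) ∧
      IsSmoothManifold (EuclideanSpace ℝ (Fin k) × EV) (AssocSpace ↥H G V) ∧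
      IsSmoothManifold (EX × EuclideanSpace ℝ (Fin k)) (RightQuotient ↥H P) ∧
      IsSmoothManifold (EX × EuclideanSpace ℝ (Fin k) × EV) (AssocSpace ↥H P V) ∧
      -- `G → G / H` is a principal `H`-bundle, and `W → G / H` is associated with it
      IsPrincipalBundle 𝓘(ℝ, EH) 𝓘(ℝ, EG) 𝓘(ℝ, EuclideanSpace ℝ (Fin k)) ↥H
        (QuotientGroup.mk : G → G ⧸ H) ∧
      IsAssociatedBundle 𝓘(ℝ, EH) 𝓘(ℝ, EG) 𝓘(ℝ, EuclideanSpace ℝ (Fin k)) 𝓘(ℝ, EV)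
        𝓘(ℝ, EuclideanSpace ℝ (Fin k) × EV) ↥H
        (QuotientGroup.mk : G → G ⧸ H) (inducedProj H V) (AssocSpace.mk ↥H) ∧
      -- `P → P / H` is a principal `H`-bundle, and `Y → P / H` is associated with it
      IsPrincipalBundle 𝓘(ℝ, EH) 𝓘(ℝ, EP) 𝓘(ℝ, EX × EuclideanSpace ℝ (Fin k)) ↥H
        (RightQuotient.mk ↥H : P → RightQuotient ↥H P) ∧
      IsAssociatedBundle 𝓘(ℝ, EH) 𝓘(ℝ, EP) 𝓘(ℝ, EX × EuclideanSpace ℝ (Fin k)) 𝓘(ℝ, EV)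
        𝓘(ℝ, EX × EuclideanSpace ℝ (Fin k) × EV) ↥H
        (RightQuotient.mk ↥H : P → RightQuotient ↥H P)
        (compositeProj H V) (AssocSpace.mk ↥H) ∧
      -- `P / H → X` is associated with `P → X`, with typical fibre `G / H`
      IsAssociatedBundle 𝓘(ℝ, EG) 𝓘(ℝ, EP) 𝓘(ℝ, EX) 𝓘(ℝ, EuclideanSpace ℝ (Fin k))
        𝓘(ℝ, EX × EuclideanSpace ℝ (Fin k)) G
        π (RightQuotient.proj H π hπ.proj_smul) (homogeneousMap H) ∧
      -- the composite `Y → P / H → X` is associated with `P → X`, with typical fibre `W`,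
      -- on which `G` acts by `g · [g', v] = [g g', v]`
      IsAssociatedBundle 𝓘(ℝ, EG) 𝓘(ℝ, EP) 𝓘(ℝ, EX) 𝓘(ℝ, EuclideanSpace ℝ (Fin k) × EV)
        𝓘(ℝ, EX × EuclideanSpace ℝ (Fin k) × EV) G
        π (RightQuotient.proj H π hπ.proj_smul ∘ compositeProj H V)
        (compositeMap H V) ∧
      -- the action of `G` on `W` covers that on `G / H`, and the fibre of `Y → P / H` is that of
      -- `W → G / H`
      (∀ (g : G) (w : AssocSpace ↥H G V), inducedProj H V (g • w) = g • inducedProj H V w) ∧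
      (∀ (p : P) (w : AssocSpace ↥H G V),
        compositeProj H V (compositeMap H V (p, w)) = homogeneousMap H (p, inducedProj H V w)) := by
  have := hG.isManifold
  have := hG.t2Space
  have := hG.secondCountableTopology
  have : IsTopologicalGroup G := topologicalGroup_of_lieGroup 𝓘(ℝ, EG) ∞
  have hval : ContMDiff 𝓘(ℝ, EH) 𝓘(ℝ, EG) ∞ (Subtype.val : ↥H → G) := hHG.contMDiff
  have hcV : ∀ h : ↥H, Continuous fun v : V => h • v := fun h =>
    hHV.contMDiff_smul.continuous.comp (continuous_const.prodMk continuous_id)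
  obtain ⟨F, _, _, hF⟩ := hHG.isImmersion
  have : FiniteDimensional ℝ F := by
    have : FiniteDimensional ℝ (EH × F) := (hF 1).equiv.symm.toLinearEquiv.finiteDimensional
    exact Module.Finite.of_surjective (LinearMap.snd ℝ EH F) LinearMap.snd_surjective
  have : CompleteSpace EH := FiniteDimensional.complete ℝ EH
  obtain ⟨csQ, hQman, hGH⟩ := exists_homogeneousSpace ((hF 1).trans_F (toEuclidean (E := F))) hval
  have hQ : IsSmoothManifold (EuclideanSpace ℝ (Fin (Module.finrank ℝ F))) (G ⧸ H) :=
    ⟨hQman, QuotientGroup.t2Space_of_isClosed hH, QuotientGroup.isOpenQuotientMap_mk.isQuotientMap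
      |>.secondCountableTopology QuotientGroup.isOpenQuotientMap_mk.isOpenMap⟩
  obtain ⟨csW, hW, hGW⟩ := hGH.exists_isAssociatedBundle_self hG hQ hV hHV
    (πY := inducedProj H V) (AssocSpace.isOpenQuotientMap_mk
      (fun h => continuous_mul_const (h : G)) hcV) (fun _ => rfl) (fun _ _ => AssocSpace.mk_eq_iff)
  have hact := hπ.contMDiff_smul.continuous
  obtain ⟨csS, hS, hPS⟩ := hπ.exists_isAssociatedBundle_self hP hX hQ (contMDiffSMul_quotient hGH)
    (πY := RightQuotient.proj H π hπ.proj_smul) (isOpenQuotientMap_homogeneousMap hact)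
    (fun a => by
      obtain ⟨p, c⟩ := a
      obtain ⟨g, rfl⟩ := QuotientGroup.mk_surjective c
      exact hπ.proj_smul p g) homogeneousMap_eq_iff
  obtain ⟨csY, hY, hPY⟩ := hπ.exists_isAssociatedBundle_self hP hX hW
    (contMDiffSMul_inducedAction hGW)
    (πY := RightQuotient.proj H π hπ.proj_smul ∘ compositeProj H V)
    (isOpenQuotientMap_compositeMap hact hcV)
    (fun a => by
      obtain ⟨p, w⟩ := a
      obtain ⟨⟨g, v⟩, rfl⟩ := Quotient.mk_surjective w
      exact hπ.proj_smul p g) compositeMap_eq_iff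
  have hPH := isPrincipalBundle_rightQuotient hval hπ hGH hPS
  refine ⟨Module.finrank ℝ F, csQ, csW, csS, csY, hQ, hW, hS, hY, hGH, hGW, hPH,
    isAssociatedBundle_rightQuotient hπ hPH hHV hGW hPY, hPS, hPY, ?_, ?_⟩
  · intro g w
    obtain ⟨⟨g', v⟩, rfl⟩ := Quotient.mk_surjective w
    rfl
  · intro p w
    obtain ⟨⟨g', v⟩, rfl⟩ := Quotient.mk_surjective w
    rfl
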